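/- **Setting.** Let $d\in\{2,3\}$, let $\Omega\subset\mathbb{R}^d$ be a bounded domain with a conforming simplicial mesh, and let $\rho$ be integrable on $\Omega$ and positive almost everywhere. Let $V_h$ be the continuous piecewise linear functions that vanish on $\partial\Omega$. Let the elements be partitioned into subdomains $\Omega_1,\dots,\Omega_N$. Let $X_i$ be the restriction of $V_h$ to $\Omega_i$, let $W_i$ be its trace on $\partial\Omega_i$, let $A^{(i)}$ be the stiffness matrix of $a_i(u,v)=\int_{\Omega_i}\rho\,\nabla u\cdot\nabla v\,dx$ on $X_i$, and let $S^{(i)}$ be its Schur complement on $W_i$. The unknowns at nodes shared by at least two subdomains form the fully coupled space $\widehat W$. They are partitioned into classes, and all nodes of a class $c$ belong to the same set $I(c)$ of subdomains. Some one-node classes are *vertices*. Any other class is a *face* if $|I(c)|=2$ and an *edge* if $|I(c)|>2$. Let $F(i)$ and $E(i)$ be the sets of faces and edges of $\Omega_i$, let $N_{F(i)}=|F(i)|$, $N_{E(i)}=|E(i)|$ and $N_{I(E)}=|I(E)|$. For $m\in I(c)$ let $S_c^{(m)}$ be the block of $S^{(m)}$ on $c$, and let $\widetilde S_c^{(m)}$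 be the Schur complement of $S^{(m)}$ after eliminating all unknowns except those of $c$. Let $D_c^{(m)}$ be arbitrary matrices (scalings) with $\sum_{m\in I(c)}D_c^{(m)}=I$. For a face or an edge $c$ put $$A_c=\sum_{m\in I(c)}\ \sum_{l\in I(c)\setminus\{m\}}(D_c^{(l)})^TS_c^{(m)}D_c^{(l)},$$ and let $\widetilde S_c$ be the parallel sum of the matrices $\widetilde S_c^{(m)}$, $m\in I(c)$, where $A:B=B(A+B)^+A$. Assume that the generalized eigenvalue problem $A_cv=\lambda\widetilde S_cv$ has a complete system of eigenvectors, orthonormal with respect to $\langle A_c\,\cdot,\cdot\rangle$, with eigenvalues in $(0,\infty]$, where $\lambda=\infty$ means $\widetilde S_cv=0$ (equivalently, $A_c$ is positive definite). Fix such a system. On each face and edge take the coefficients with respect to these eigenvectors as the new unknowns, and transform $S^{(i)}$ and the block diagonal matrices $D_i=\mathrm{diag}(D_c^{(i)})$ accordingly: $S_a^{(i)}=P_i^TS^{(i)}P_i$ and $\check D_i=P_i^{-1}D_iP_i$, where $P_i$ is the block diagonal change of basis matrix on $W_i$. The primal unknowns are those at vertices, the coefficients of face eigenvectors with $\lambda\ge\lambda_{TOL}$,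 and the coefficients of edge eigenvectors with $\lambda>\lambda_{TOL}$. The other unknowns are dual. The partially coupled space $\widetilde W$ has one copy of each primal unknown and, for each subdomain, a separate copy of each of its dual unknowns. Let $\widetilde R_i:\widetilde W\to W_i$ be the restriction, let $\widetilde R:\widehat W\to\widetilde W$ be the natural embedding, and put $$\widetilde S_a=\sum_i\widetilde R_i^TS_a^{(i)}\widetilde R_i,\qquad \widetilde D=\sum_i\widetilde R_i^T\check D_i\widetilde R_i,\qquad M_{BDDC,a}^{-1}=\widetilde R^T\widetilde D\,\widetilde S_a^{-1}\widetilde D^T\widetilde R .$$ Let $\kappa$ denote the ratio of the largest to the smallest eigenvalue, and let $$C=8\max\Big\{\max_iN_{F(i)}^2,\ \max_i\Big(N_{E(i)}^2\max_{E\in E(i)}N_{I(E)}\Big)\Big\},$$ where a maximum over the empty set is $0$. **Theorem.** Let $\lambda_{TOL}$ be a real number with $C\lambda_{TOL}\ge1$ (this excludes only tolerances for which the bound would be smaller than $1$, the least possible value of a condition number). Then $\widetilde S_a$, $\widetilde R^T\widetilde S_a\widetilde R$ and $M_{BDDC,a}^{-1}$ are symmetric positive definite, and $$\kappa\big(M_{BDDC,a}^{-1}\,\widetilde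 R^T\widetilde S_a\widetilde R\big)\le C\,\lambda_{TOL}.$$ -/

import Mathlib

open scoped Matrix ENNReal

noncomputable section

open scoped Classical

namespace BDDC

/-! ### Linear algebra -/

section LinearAlgebra

variable {m n : Type*} [Fintype m] [Fintype n]

/-- The four Penrose conditions: `X` is the Moore–Penrose pseudo-inverse of the real matrix `A`. -/
structure IsPseudoInverse (A : Matrix m n ℝ) (X : Matrix n m ℝ) : Prop where
  mul_mul_self : A * X * A = A
  self_mul_mul : X * A * X = X
  symm_left : (A * X)ᵀ = A * X
  symm_right : (X * A)ᵀ = X * A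

theorem IsPseudoInverse.unique {A : Matrix m n ℝ} {X Y : Matrix n m ℝ}
    (hX : IsPseudoInverse A X) (hY : IsPseudoInverse A Y) : X = Y := by
  have e1 : A * X = A * Y := by
    calc A * X = (A * X)ᵀ := hX.symm_left.symm
      _ = ((A * Y) * (A * X))ᵀ := by
          rw [← Matrix.mul_assoc, hY.mul_mul_self]
      _ = (A * X)ᵀ * (A * Y)ᵀ := by rw [Matrix.transpose_mul]
      _ = (A * X) * (A * Y) := by rw [hX.symm_left, hY.symm_left]
      _ = A * Y := by rw [← Matrix.mul_assoc, hX.mul_mul_self]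
  have e2 : X * A = Y * A := by
    calc X * A = (X * A)ᵀ := hX.symm_right.symm
      _ = ((X * A) * (Y * A))ᵀ := by
          rw [Matrix.mul_assoc X A (Y * A), ← Matrix.mul_assoc A Y A, hY.mul_mul_self]
      _ = (Y * A)ᵀ * (X * A)ᵀ := by rw [Matrix.transpose_mul]
      _ = (Y * A) * (X * A) := by rw [hX.symm_right, hY.symm_right]
      _ = Y * A := by rw [Matrix.mul_assoc Y A (X * A), ← Matrix.mul_assoc A X A, hX.mul_mul_self]
  calc X = X * A * X := hX.self_mul_mul.symm
    _ = Y * A * X := by rw [e2]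
    _ = Y * (A * X) := by rw [Matrix.mul_assoc]
    _ = Y * (A * Y) := by rw [e1]
    _ = Y := by rw [← Matrix.mul_assoc, hY.self_mul_mul]

theorem IsPseudoInverse.exists_of_isHermitian {A : Matrix n n ℝ} (hA : A.IsHermitian) :
    ∃ X, IsPseudoInverse A X := by
  set U : Matrix n n ℝ := (hA.eigenvectorUnitary : Matrix n n ℝ) with hU
  have hUU : Uᵀ * U = 1 := by
    have := Unitary.coe_star_mul_self hA.eigenvectorUnitary
    simpa [Matrix.star_eq_conjTranspose, Matrix.conjTranspose_eq_transpose_of_trivial] using this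
  set v : n → ℝ := hA.eigenvalues with hv
  have hAe : A = U * Matrix.diagonal v * Uᵀ := by
    have := hA.spectral_theorem
    rw [Unitary.conjStarAlgAut_apply] at this
    simpa [Matrix.star_eq_conjTranspose, Matrix.conjTranspose_eq_transpose_of_trivial,
      Function.comp_def] using this
  have key : ∀ a b : n → ℝ, (U * Matrix.diagonal a * Uᵀ) * (U * Matrix.diagonal b * Uᵀ)
      = U * Matrix.diagonal (fun i => a i * b i) * Uᵀ := by
    intro a b
    calc (U * Matrix.diagonal a * Uᵀ) * (U * Matrix.diagonal b * Uᵀ)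
        = U * Matrix.diagonal a * (Uᵀ * U) * Matrix.diagonal b * Uᵀ := by
          simp only [Matrix.mul_assoc]
      _ = _ := by rw [hUU, Matrix.mul_one, Matrix.mul_assoc U, Matrix.diagonal_mul_diagonal]
  have ht : ∀ a : n → ℝ, (U * Matrix.diagonal a * Uᵀ)ᵀ = U * Matrix.diagonal a * Uᵀ := by
    intro a
    simp [Matrix.transpose_mul, Matrix.mul_assoc]
  refine ⟨U * Matrix.diagonal (fun i => (v i)⁻¹) * Uᵀ, ?_, ?_, ?_, ?_⟩
  · rw [hAe, key, key]; congr 3; funext i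
    by_cases h : v i = 0 <;> simp [h]
  · rw [hAe, key, key]; congr 3; funext i
    by_cases h : v i = 0 <;> simp [h]
  · rw [hAe, key, ht]
  · rw [hAe, key, ht]

/-- The Moore–Penrose pseudo-inverse `A⁺`. -/
def pinv (A : Matrix m n ℝ) : Matrix n m ℝ :=
  if h : ∃ X, IsPseudoInverse A X then h.choose else 0

theorem isPseudoInverse_pinv {A : Matrix n n ℝ} (hA : A.IsHermitian) :
    IsPseudoInverse A (pinv A) := by
  have h := IsPseudoInverse.exists_of_isHermitian hA
  rw [pinv, dif_pos h]
  exact h.choose_spec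

/-- The Schur complement of `A` after eliminating all unknowns that do not satisfy `K`.
When the eliminated block is invertible, its pseudo-inverse is its inverse. -/
def schur (A : Matrix n n ℝ) (K : n → Prop) : Matrix {a // K a} {a // K a} ℝ :=
  A.toBlock K K - A.toBlock K (fun a => ¬ K a) *
    pinv (A.toBlock (fun a => ¬ K a) (fun a => ¬ K a)) * A.toBlock (fun a => ¬ K a) K

/-- The parallel sum `A : B = B (A + B)⁺ A`. -/
def parallelSum (A B : Matrix n n ℝ) : Matrix n n ℝ :=
  B * pinv (A + B) * A

/-- The iterated parallel sum `A₁ : (A₂ : (⋯ : Aₖ))` of a nonempty list of matrices. -/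
def parallelSumList : List (Matrix n n ℝ) → Matrix n n ℝ
  | [] => 0
  | [A] => A
  | A :: B :: L => parallelSum A (parallelSumList (B :: L))

/-- A complete system of generalized eigenpairs of `A v = λ B v` with eigenvalues in `[0, ∞]`,
normalized with respect to the form `⟨A ·, ·⟩`. The eigenvalue `∞` means `B v = 0`. -/
structure EigenBasis (A B : Matrix n n ℝ) where
  vec : n → n → ℝ
  val : n → ℝ≥0∞
  normalized : ∀ k l, (A *ᵥ vec k) ⬝ᵥ vec l = if k = l then 1 else 0
  eigen : ∀ l, (val l ≠ ∞ ∧ A *ᵥ vec l = (val l).toReal • (B *ᵥ vec l)) ∨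
    (val l = ∞ ∧ B *ᵥ vec l = 0)

/-- The condition number `λ_max / λ_min` of a matrix all of whose eigenvalues are positive reals. -/
def condNumber (T : Matrix n n ℝ) : ℝ :=
  sSup (spectrum ℝ T) / sInf (spectrum ℝ T)

end LinearAlgebra

/-! ### The finite element problem -/

/-- A conforming simplicial mesh (nodes `ι`, elements `τ`) of a bounded region of `ℝᵈ`, a partition
of its elements into `N` subdomains, and a positive integrable coefficient `ρ`. -/
structure Problem (d N : ℕ) (ι τ : Type*) where
  pos : ι → EuclideanSpace ℝ (Fin d)
  pos_injective : Function.Injective pos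
  /-- the `d + 1` vertices of an element -/
  vert : τ → Fin (d + 1) → ι
  affineIndependent : ∀ T, AffineIndependent ℝ fun j => pos (vert T j)
  vert_ne : ∀ T T', Set.range (vert T) = Set.range (vert T') → T = T'
  node_mem : ∀ x, ∃ T, x ∈ Set.range (vert T)
  /-- two elements meet in the simplex spanned by their common vertices -/
  conforming : ∀ T T',
    convexHull ℝ (pos '' Set.range (vert T)) ∩ convexHull ℝ (pos '' Set.range (vert T')) =
      convexHull ℝ (pos '' (Set.range (vert T) ∩ Set.range (vert T')))
  /-- the subdomain containing an element -/
  sub : τ → Fin N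
  ρ : EuclideanSpace ℝ (Fin d) → ℝ
  ρ_integrable : ∀ T, MeasureTheory.IntegrableOn ρ (convexHull ℝ (pos '' Set.range (vert T)))
  ρ_pos : ∀ T, ∀ᵐ x ∂MeasureTheory.volume.restrict (convexHull ℝ (pos '' Set.range (vert T))),
    0 < ρ x

namespace Problem

variable {d N : ℕ} {ι τ : Type*} [Fintype ι] [Fintype τ] (P : Problem d N ι τ)

/-- The closed simplex of an element. -/
def simplex (T : τ) : Set (EuclideanSpace ℝ (Fin d)) :=
  convexHull ℝ (P.pos '' Set.range (P.vert T))

/-- The closure of the domain `Ω`. -/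
def closedDomain : Set (EuclideanSpace ℝ (Fin d)) := ⋃ T, P.simplex T

/-- The node lies on `∂Ω`. -/
def OnBoundary (x : ι) : Prop := P.pos x ∈ frontier P.closedDomain

/-- The set of the subdomains whose closure contains the node `x`. -/
def shared (x : ι) : Finset (Fin N) :=
  Finset.univ.filter fun i => ∃ T, P.sub T = i ∧ x ∈ Set.range (P.vert T)

/-- The matrix whose rows are the edge vectors `p_k - p_0` of an element. -/
def edgeMatrix (T : τ) : Matrix (Fin d) (Fin d) ℝ :=
  Matrix.of fun k j => P.pos (P.vert T k.succ) j - P.pos (P.vert T 0) j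

/-- The constant gradient, on the element `T`, of the continuous piecewise linear function with
nodal values `u`. -/
def grad (T : τ) (u : ι → ℝ) : Fin d → ℝ :=
  (P.edgeMatrix T)⁻¹ *ᵥ fun k => u (P.vert T k.succ) - u (P.vert T 0)

/-- `a_i(u,v) = ∫_{Ω_i} ρ ∇u · ∇v` for the piecewise linear functions with nodal values `u`, `v`. -/
def form (i : Fin N) (u v : ι → ℝ) : ℝ :=
  ∑ T ∈ Finset.univ.filter (fun T => P.sub T = i),
    ∫ x in P.simplex T, P.ρ x * (P.grad T u ⬝ᵥ P.grad T v)

/-- The unknowns of `X_i`: nodes of `Ω_i` off `∂Ω`. -/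
abbrev X (i : Fin N) : Type _ := {x : ι // ¬ P.OnBoundary x ∧ i ∈ P.shared x}

instance (i : Fin N) : Fintype (P.X i) := Subtype.fintype _

/-- The unknowns of `W_i`: the unknowns of `X_i` on `∂Ω_i`, that is, shared with another
subdomain. -/
abbrev W (i : Fin N) : Type _ := {a : P.X i // 2 ≤ (P.shared a.1).card}

instance (i : Fin N) : Fintype (P.W i) := Subtype.fintype _

/-- The interface unknowns, that is, the unknowns of the fully coupled space `Ŵ`. -/
abbrev Γ : Type _ := {x : ι // ¬ P.OnBoundary x ∧ 2 ≤ (P.shared x).card}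

instance : Fintype P.Γ := Subtype.fintype _

/-- The interface unknown of which `a` is the copy in `Ω_i`. -/
def toΓ (i : Fin N) (a : P.W i) : P.Γ := ⟨a.1.1, a.1.2.1, a.2⟩

/-- The copy in `Ω_i` of an interface unknown on `∂Ω_i`. -/
def ofΓ (i : Fin N) (x : P.Γ) (h : i ∈ P.shared x.1) : P.W i := ⟨⟨x.1, x.2.1, h⟩, x.2.2⟩

/-- The local stiffness matrix `A⁽ⁱ⁾`. -/
def stiffness (i : Fin N) : Matrix (P.X i) (P.X i) ℝ :=
  Matrix.of fun a b => P.form i (Pi.single a.1 1) (Pi.single b.1 1)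

/-- `S⁽ⁱ⁾`: the Schur complement of `A⁽ⁱ⁾` after eliminating the unknowns interior to `Ω_i`. -/
def S (i : Fin N) : Matrix (P.W i) (P.W i) ℝ :=
  schur (P.stiffness i) fun a => 2 ≤ (P.shared a.1).card

end Problem

/-! ### Vertices, edges and faces -/

/-- The decomposition of the interface unknowns into equivalence classes. Unknowns of one class
belong to the same subdomains. Some one-element classes are declared vertices. -/
structure Interface {d N : ℕ} {ι τ : Type*} [Fintype ι] [Fintype τ] (P : Problem d N ι τ) where
  rel : Setoid P.Γ
  shared_eq : ∀ x y, rel x y → P.shared x.1 = P.shared y.1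
  IsVertex : Quotient rel → Prop
  eq_of_isVertex : ∀ x y, rel x y → IsVertex (Quotient.mk rel x) → x = y

namespace Interface

variable {d N : ℕ} {ι τ : Type*} [Fintype ι] [Fintype τ] {P : Problem d N ι τ} (G : Interface P)

/-- The equivalence classes. -/
abbrev Class : Type _ := Quotient G.rel

instance : Fintype G.Class := Quotient.fintype G.rel

/-- The class of an interface unknown. -/
def cls (x : P.Γ) : G.Class := Quotient.mk G.rel x

/-- `I(c)`: the set of the subdomains sharing the class `c`. -/
def I (c : G.Class) : Finset (Fin N) :=
  Quotient.lift (fun x : P.Γ => P.shared x.1) (fun x y h => G.shared_eq x y h) c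

/-- A face is a class shared by exactly two subdomains. -/
def IsFace (c : G.Class) : Prop := ¬ G.IsVertex c ∧ (G.I c).card = 2

/-- An edge is a class shared by more than two subdomains. -/
def IsEdge (c : G.Class) : Prop := ¬ G.IsVertex c ∧ 2 < (G.I c).card

/-- `F(i)`: the faces of `Ω_i`. -/
def faces (i : Fin N) : Finset G.Class := Finset.univ.filter fun c => G.IsFace c ∧ i ∈ G.I c

/-- `E(i)`: the edges of `Ω_i`. -/
def edges (i : Fin N) : Finset G.Class := Finset.univ.filter fun c => G.IsEdge c ∧ i ∈ G.I c

/-- `8 max { max_i N_{F(i)}², max_i ( N_{E(i)}² max_{E ∈ E(i)} N_{I(E)} ) }`, where a maximum over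
the empty set is `0`. -/
def constC : ℕ :=
  8 * max (Finset.univ.sup fun i => (G.faces i).card ^ 2)
    (Finset.univ.sup fun i => (G.edges i).card ^ 2 * (G.edges i).sup fun E => (G.I E).card)

/-- The unknowns of a class. -/
abbrev Dof (c : G.Class) : Type _ := {x : P.Γ // G.cls x = c}

instance (c : G.Class) : Fintype (G.Dof c) := Subtype.fintype _

theorem mem_shared {c : G.Class} (m : G.I c) (x : G.Dof c) : m.1 ∈ P.shared x.1.1 := by
  obtain ⟨x, rfl⟩ := x
  exact m.2

/-- The copies in `Ω_m` of the unknowns of a class shared by `Ω_m`. -/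
def emb (c : G.Class) (m : G.I c) (x : G.Dof c) : P.W m.1 := P.ofΓ m.1 x.1 (G.mem_shared m x)

/-- `S_c⁽ᵐ⁾`: the block of `S⁽ᵐ⁾` on the unknowns of the class `c`. -/
def block (c : G.Class) (m : G.I c) : Matrix (G.Dof c) (G.Dof c) ℝ :=
  (P.S m.1).submatrix (G.emb c m) (G.emb c m)

/-- `S̃_c⁽ᵐ⁾`: the Schur complement of `S⁽ᵐ⁾` after eliminating all unknowns except those of the
class `c`. -/
def schurBlock (c : G.Class) (m : G.I c) : Matrix (G.Dof c) (G.Dof c) ℝ :=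
  (schur (P.S m.1) fun a => G.cls (P.toΓ m.1 a) = c).submatrix
    (fun x => ⟨G.emb c m x, x.2⟩) (fun x => ⟨G.emb c m x, x.2⟩)

/-- The parallel sum of the matrices `S̃_c⁽ᵐ⁾`, `m ∈ I(c)`. For a face it has two terms. -/
def tildeS (c : G.Class) : Matrix (G.Dof c) (G.Dof c) ℝ :=
  parallelSumList (((Finset.univ : Finset (G.I c)).sort).map (G.schurBlock c))

/-- Scaling matrices with the partition of unity property. -/
structure Scaling where
  D : (c : G.Class) → G.I c → Matrix (G.Dof c) (G.Dof c) ℝ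
  sum_eq_one : ∀ c, ∑ m, D c m = 1

variable {G}

/-- `∑_{m ∈ I(c)} ∑_{l ∈ I(c) \ {m}} (D_c⁽ˡ⁾)ᵀ S_c⁽ᵐ⁾ D_c⁽ˡ⁾`. This is `A_E` when `c` is an edge `E`.
When `c` is a face `F` of `Ω_i` and `Ω_j`, it is
`A_F = (D_F⁽ʲ⁾)ᵀ S_F⁽ⁱ⁾ D_F⁽ʲ⁾ + (D_F⁽ⁱ⁾)ᵀ S_F⁽ʲ⁾ D_F⁽ⁱ⁾`. -/
def Scaling.A (s : G.Scaling) (c : G.Class) : Matrix (G.Dof c) (G.Dof c) ℝ :=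
  ∑ m, ∑ l ∈ Finset.univ.erase m, (s.D c l)ᵀ * G.block c m * s.D c l

/-- The scaling matrix `D_i` on `W_i`, block diagonal with blocks `D_c⁽ⁱ⁾`. -/
def Scaling.local (s : G.Scaling) (i : Fin N) : Matrix (P.W i) (P.W i) ℝ :=
  Matrix.of fun a b =>
    if h : G.cls (P.toΓ i b) = G.cls (P.toΓ i a) then
      s.D (G.cls (P.toΓ i a)) ⟨i, a.1.2.2⟩ ⟨P.toΓ i a, rfl⟩ ⟨P.toΓ i b, h⟩
    else 0

end Interface

/-! ### The BDDC preconditioner after the change of basis -/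

/-- A complete system of normalized eigenvectors of the generalized eigenvalue problem
`A_F v = λ (S̃_F⁽ⁱ⁾ : S̃_F⁽ʲ⁾) v`, `A_E v = λ S̃_E v` of each face and each edge. -/
def Interface.Scaling.EigenSystem {d N : ℕ} {ι τ : Type*} [Fintype ι] [Fintype τ]
    {P : Problem d N ι τ} {G : Interface P} (s : G.Scaling) : Type _ :=
  (c : G.Class) → ¬ G.IsVertex c → EigenBasis (s.A c) (G.tildeS c)

namespace Interface.Scaling.EigenSystem

variable {d N : ℕ} {ι τ : Type*} [Fintype ι] [Fintype τ] {P : Problem d N ι τ}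
  {G : Interface P} {s : G.Scaling} (B : s.EigenSystem) (tol : ℝ)

/-- After the change of basis the unknowns of a face or an edge are the coefficients with respect
to its eigenvectors. An unknown is primal if it is at a vertex, or if its eigenvalue is `≥ λ_TOL`
(on a face) or `> λ_TOL` (on an edge). -/
def IsPrimal (x : P.Γ) : Prop :=
  ∀ h : ¬ G.IsVertex (G.cls x),
    (G.IsFace (G.cls x) ∧ ENNReal.ofReal tol ≤ (B (G.cls x) h).val ⟨x, rfl⟩) ∨
    (G.IsEdge (G.cls x) ∧ ENNReal.ofReal tol < (B (G.cls x) h).val ⟨x, rfl⟩)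

/-- The change of basis matrix of a class: its columns are the eigenvectors of a face or an edge.
At a vertex it is the identity. -/
def changeBlock (c : G.Class) : Matrix (G.Dof c) (G.Dof c) ℝ :=
  if h : G.IsVertex c then 1 else Matrix.of fun x l => (B c h).vec l x

/-- The block diagonal change of basis matrix on `W_i`. -/
def change (i : Fin N) : Matrix (P.W i) (P.W i) ℝ :=
  Matrix.of fun a b =>
    if h : G.cls (P.toΓ i b) = G.cls (P.toΓ i a) then
      B.changeBlock (G.cls (P.toΓ i a)) ⟨P.toΓ i a, rfl⟩ ⟨P.toΓ i b, h⟩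
    else 0

/-- The transformed matrix `S⁽ⁱ⁾`. -/
def S (i : Fin N) : Matrix (P.W i) (P.W i) ℝ := (B.change i)ᵀ * P.S i * B.change i

/-- The transformed scaling matrix `D_i`. -/
def D (i : Fin N) : Matrix (P.W i) (P.W i) ℝ :=
  (B.change i)⁻¹ * s.local i * B.change i

/-- The unknowns of the partially coupled space: a copy of each dual unknown for each subdomain,
and a single primal unknown for all subdomains. -/
abbrev Wt : Type _ :=
  (Σ i : Fin N, {a : P.W i // ¬ B.IsPrimal tol (P.toΓ i a)}) ⊕ {x : P.Γ // B.IsPrimal tol x}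

instance : Fintype (B.Wt tol) := instFintypeSum _ _

/-- The restriction `R̃_i` from the partially coupled space to `W_i`. -/
def Rt (i : Fin N) : Matrix (P.W i) (B.Wt tol) ℝ :=
  Matrix.of fun a t => match t with
    | Sum.inl y => if (⟨i, a⟩ : Σ i, P.W i) = ⟨y.1, y.2.1⟩ then 1 else 0
    | Sum.inr x => if P.toΓ i a = x.1 then 1 else 0

/-- The embedding `R̃` of the fully coupled space into the partially coupled space. -/
def R : Matrix (B.Wt tol) P.Γ ℝ :=
  Matrix.of fun t x => match t with
    | Sum.inl y => if P.toΓ y.1 y.2.1 = x then 1 else 0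
    | Sum.inr y => if y.1 = x then 1 else 0

/-- The partially coupled matrix `S̃_a`. -/
def St : Matrix (B.Wt tol) (B.Wt tol) ℝ := ∑ i, (B.Rt tol i)ᵀ * B.S i * B.Rt tol i

/-- The scaling matrix `D̃` on the partially coupled space. -/
def Dt : Matrix (B.Wt tol) (B.Wt tol) ℝ := ∑ i, (B.Rt tol i)ᵀ * B.D i * B.Rt tol i

/-- The interface matrix `R̃ᵀ S̃_a R̃`. -/
def interfaceMatrix : Matrix P.Γ P.Γ ℝ := (B.R tol)ᵀ * B.St tol * B.R tol

/-- The preconditioner `M⁻¹ = R̃ᵀ D̃ S̃_a⁻¹ D̃ᵀ R̃`. -/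
def precond : Matrix P.Γ P.Γ ℝ := (B.R tol)ᵀ * B.Dt tol * (B.St tol)⁻¹ * (B.Dt tol)ᵀ * B.R tol

/-- The preconditioned matrix `M⁻¹ R̃ᵀ S̃_a R̃`. -/
def preconditioned : Matrix P.Γ P.Γ ℝ := B.precond tol * B.interfaceMatrix tol

end Interface.Scaling.EigenSystem

end BDDC

end

/-!
The condition number bound for the adaptive BDDC preconditioner.

Write `|w|²` for the energy of `S̃_a`, which is the sum of the energies of the matrices `S⁽ⁱ⁾` at the
nodal values of `w` in `Ω_i`. The averaging operator `R̃ᵀ D̃` is a left inverse of the embedding `R̃`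
(`average_R_mulVec`), because the scalings are a partition of unity, so `E = R̃ R̃ᵀ D̃` is a
projection onto the fully coupled space. If `λ, u` is an eigenpair of the preconditioned matrix, put
`x = R̃ u` and `y = S̃_a⁻¹ D̃ᵀ R̃ R̃ᵀ S̃_a R̃ u`. Then `⟨x, y⟩ = |x|²`, `|y|² = λ |x|²` and `E y = λ x`;
hence `|x - y|² ≥ 0` gives `λ ≥ 1`, and an estimate `|z - E z|² ≤ K |z|²` of the jump, applied to
`z = x - y`, gives `λ ≤ K` (`mem_Icc_of_mem_spectrum`).

The jump estimate (`energy_jump_le`) holds with `K = C λ_TOL`. On a class `c` the primal parts of the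
nodal values in different subdomains agree and cancel, so only the dual parts `v_m` enter. These are
combinations of eigenvectors with eigenvalue at most `λ_TOL`, so their `A_c`-energy is at most
`λ_TOL` times the `S̃_c`-energy of the nodal values (`EigenBasis.energy_mat_mulVec_le`). The latter is
at most the energy of `w` in `Ω_m`, because a parallel sum is bounded by each of its terms
(`parallelSumList_spec`) and Schur complements minimize the energy (`energy_schur_le`). Conversely
the local energies of the jumps on `c` add up to at most `2 (|I(c)| - 1)` times the sum of the
`A_c`-energies of the `v_m` (`sum_energy_jump_le`). Summing over faces and edges
(`sum_card_mul_sum_le`) gives the constant.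

That `S̃_a` is positive definite (`posDef_St`) follows from the same inequality: an element without
energy has no dual part, hence lies in the fully coupled space. Its local harmonic extensions form a
finite element function with zero gradient, which vanishes on the boundary, hence is zero
(`Problem.eq_zero_of_energy_S_eq_zero`).
-/

namespace BDDC

open scoped Classical

/-! ### Energies of positive semidefinite matrices -/

theorem transpose_eq_of_isHermitian {n : Type*} {A : Matrix n n ℝ} (hA : A.IsHermitian) :
    Aᵀ = A := by
  simpa [Matrix.IsHermitian, Matrix.conjTranspose_eq_transpose_of_trivial] using hA

theorem isHermitian_of_transpose_eq {n : Type*} {A : Matrix n n ℝ} (hA : Aᵀ = A) :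
    A.IsHermitian := by
  simpa [Matrix.IsHermitian, Matrix.conjTranspose_eq_transpose_of_trivial] using hA

section Energy

variable {m n : Type*} [Fintype m] [Fintype n]

/-- The quadratic form `xᵀ A x` of a matrix. -/
def energy (A : Matrix n n ℝ) (x : n → ℝ) : ℝ := x ⬝ᵥ A *ᵥ x

theorem energy_nonneg {A : Matrix n n ℝ} (hA : A.PosSemidef) (x : n → ℝ) : 0 ≤ energy A x := by
  simpa [energy] using hA.dotProduct_mulVec_nonneg x

theorem mulVec_eq_zero_of_energy_eq_zero {A : Matrix n n ℝ} (hA : A.PosSemidef) {x : n → ℝ}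
    (hx : energy A x = 0) : A *ᵥ x = 0 :=
  (hA.dotProduct_mulVec_zero_iff x).1 (by simpa [energy] using hx)

theorem posSemidef_of_energy_nonneg {A : Matrix n n ℝ} (hA : Aᵀ = A)
    (h : ∀ x, 0 ≤ energy A x) : A.PosSemidef :=
  .of_dotProduct_mulVec_nonneg (isHermitian_of_transpose_eq hA) (by simpa [energy] using h)

theorem posDef_of_posSemidef_of_energy {A : Matrix n n ℝ} (hA : A.PosSemidef)
    (h : ∀ x, energy A x = 0 → x = 0) : A.PosDef :=
  .of_dotProduct_mulVec_pos hA.1 fun x hx => by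
    have h1 := energy_nonneg hA x
    have h2 : energy A x ≠ 0 := fun e => hx (h x e)
    simpa [energy] using lt_of_le_of_ne h1 h2.symm

theorem dotProduct_mulVec_comm {A : Matrix n n ℝ} (hA : Aᵀ = A) (x y : n → ℝ) :
    x ⬝ᵥ A *ᵥ y = y ⬝ᵥ A *ᵥ x := by
  rw [Matrix.dotProduct_mulVec, ← Matrix.mulVec_transpose, hA, dotProduct_comm]

theorem energy_add {A : Matrix n n ℝ} (hA : Aᵀ = A) (x y : n → ℝ) :
    energy A (x + y) = energy A x + 2 * (x ⬝ᵥ A *ᵥ y) + energy A y := by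
  simp only [energy, Matrix.mulVec_add, dotProduct_add, add_dotProduct,
    dotProduct_mulVec_comm hA y x]
  ring

theorem energy_sub {A : Matrix n n ℝ} (hA : Aᵀ = A) (x y : n → ℝ) :
    energy A (x - y) = energy A x - 2 * (x ⬝ᵥ A *ᵥ y) + energy A y := by
  simp only [energy, Matrix.mulVec_sub, dotProduct_sub, sub_dotProduct,
    dotProduct_mulVec_comm hA y x]
  ring

theorem energy_smul (A : Matrix n n ℝ) (t : ℝ) (x : n → ℝ) :
    energy A (t • x) = t ^ 2 * energy A x := by
  simp only [energy, Matrix.mulVec_smul, dotProduct_smul, smul_dotProduct, smul_eq_mul]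
  ring

theorem energy_matrix_add (A B : Matrix n n ℝ) (x : n → ℝ) :
    energy (A + B) x = energy A x + energy B x := by
  simp [energy, Matrix.add_mulVec, dotProduct_add]

theorem energy_matrix_sum {κ : Type*} (s : Finset κ) (A : κ → Matrix n n ℝ) (x : n → ℝ) :
    energy (∑ k ∈ s, A k) x = ∑ k ∈ s, energy (A k) x := by
  simp only [energy, Matrix.sum_mulVec, dotProduct_sum]

theorem energy_transpose_mul_mul (A : Matrix n n ℝ) (C : Matrix n m ℝ) (x : m → ℝ) :
    energy (Cᵀ * A * C) x = energy A (C *ᵥ x) := by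
  simp only [energy, ← Matrix.mulVec_mulVec]
  rw [Matrix.dotProduct_mulVec x, Matrix.vecMul_transpose]

theorem energy_add_le {A : Matrix n n ℝ} (hA : A.PosSemidef) (x y : n → ℝ) :
    energy A (x + y) ≤ 2 * energy A x + 2 * energy A y := by
  have hT := transpose_eq_of_isHermitian hA.1
  have h := energy_nonneg hA (x - y)
  rw [energy_sub hT] at h
  rw [energy_add hT]
  linarith

theorem energy_sub_le {A : Matrix n n ℝ} (hA : A.PosSemidef) (x y : n → ℝ) :
    energy A (x - y) ≤ 2 * energy A x + 2 * energy A y := by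
  have hT := transpose_eq_of_isHermitian hA.1
  have h := energy_nonneg hA (x + y)
  rw [energy_add hT] at h
  rw [energy_sub hT]
  linarith

theorem energy_sum_le {κ : Type*} {A : Matrix n n ℝ} (hA : A.PosSemidef) (s : Finset κ)
    (x : κ → n → ℝ) : energy A (∑ k ∈ s, x k) ≤ s.card * ∑ k ∈ s, energy A (x k) := by
  have hT := transpose_eq_of_isHermitian hA.1
  -- the defect is half the sum of the energies of all the differences
  have h : 0 ≤ ∑ k ∈ s, ∑ l ∈ s, energy A (x k - x l) :=
    Finset.sum_nonneg fun k _ => Finset.sum_nonneg fun l _ => energy_nonneg hA _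
  have e : energy A (∑ k ∈ s, x k) = ∑ k ∈ s, ∑ l ∈ s, x k ⬝ᵥ A *ᵥ x l := by
    simp only [energy, Matrix.mulVec_sum, dotProduct_sum, sum_dotProduct]
    rw [Finset.sum_comm]
  simp only [energy_sub hT, Finset.sum_add_distrib, Finset.sum_sub_distrib, ← Finset.mul_sum,
    ← e, Finset.sum_const, nsmul_eq_mul] at h
  linarith

end Energy

/-! ### Schur complements and parallel sums -/

section Schur

variable {n : Type*} [Fintype n]

theorem pinv_transpose {A : Matrix n n ℝ} (hA : Aᵀ = A) : (pinv A)ᵀ = pinv A := by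
  have h := isPseudoInverse_pinv (isHermitian_of_transpose_eq hA)
  refine IsPseudoInverse.unique (A := A) ⟨?_, ?_, ?_, ?_⟩ h
  · have := congrArg Matrix.transpose h.mul_mul_self
    simpa [Matrix.transpose_mul, hA, Matrix.mul_assoc] using this
  · have := congrArg Matrix.transpose h.self_mul_mul
    simpa [Matrix.transpose_mul, hA, Matrix.mul_assoc] using this
  · have := h.symm_right
    simp only [Matrix.transpose_mul, hA, Matrix.transpose_transpose] at this ⊢
    exact this.symm
  · have := h.symm_left
    simp only [Matrix.transpose_mul, hA, Matrix.transpose_transpose] at this ⊢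
    exact this.symm

/-- If `A` vanishes on the kernel of the symmetric matrix `M`, then `A M⁺ M = A`. -/
theorem mul_pinv_mul_of_ker_le {m : Type*} {M : Matrix n n ℝ} (hM : Mᵀ = M) (A : Matrix m n ℝ)
    (h : ∀ y, M *ᵥ y = 0 → A *ᵥ y = 0) : A * pinv M * M = A := by
  have hp := isPseudoInverse_pinv (isHermitian_of_transpose_eq hM)
  refine Matrix.ext_of_mulVec_single fun i => ?_
  set v : n → ℝ := Pi.single i 1
  have h1 : M *ᵥ (v - (pinv M * M) *ᵥ v) = 0 := by
    rw [Matrix.mulVec_sub, Matrix.mulVec_mulVec, ← Matrix.mul_assoc, hp.mul_mul_self, sub_self]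
  have h2 := h _ h1
  rw [Matrix.mulVec_sub, Matrix.mulVec_mulVec, ← Matrix.mul_assoc, sub_eq_zero] at h2
  exact h2.symm

theorem sum_subtype_add_sum_subtype_not (K : n → Prop) (f : n → ℝ) :
    ∑ a, f a = ∑ a : {a // K a}, f a + ∑ a : {a // ¬ K a}, f a :=
  (Fintype.sum_subtype_add_sum_subtype K f).symm

theorem mulVec_eq_toBlock_add (A : Matrix n n ℝ) (K L : n → Prop) (v : n → ℝ) (a : {a // L a}) :
    (A *ᵥ v) a = (A.toBlock L K *ᵥ fun b => v b) a
      + (A.toBlock L (fun b => ¬ K b) *ᵥ fun b => v b) a :=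
  sum_subtype_add_sum_subtype_not K fun b => A a b * v b

/-- The discrete harmonic extension `g` of `x`: the eliminated equations hold, and the residual in
the remaining ones is given by the Schur complement. -/
theorem exists_harmonic_extension {A : Matrix n n ℝ} (hA : A.PosSemidef) (K : n → Prop)
    (x : {a // K a} → ℝ) :
    ∃ g : n → ℝ, (∀ a : {a // K a}, g a = x a) ∧ (∀ a : {a // K a}, (A *ᵥ g) a =
      (schur A K *ᵥ x) a) ∧ ∀ a, ¬ K a → (A *ᵥ g) a = 0 := by
  have hT := transpose_eq_of_isHermitian hA.1
  set N : n → Prop := fun a => ¬ K a with hN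
  have hNN : (A.toBlock N N)ᵀ = A.toBlock N N := by
    ext a b
    exact congrFun (congrFun hT a) b
  have hKN : (A.toBlock K N)ᵀ = A.toBlock N K := by
    ext a b
    exact congrFun (congrFun hT a) b
  -- the kernel of the eliminated block is contained in that of the coupling block
  have hker : ∀ y, A.toBlock N N *ᵥ y = 0 → A.toBlock K N *ᵥ y = 0 := by
    intro y hy
    set v : n → ℝ := fun a => if h : K a then 0 else y ⟨a, h⟩
    have vK : (fun b : {b // K b} => v b) = 0 := by
      funext b; simp [v, b.2]
    have vN : (fun b : {b // N b} => v b) = y := by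
      funext b
      have : ¬ K b := b.2
      simp [v, this]
    have hAvN : ∀ a : {a // N a}, (A *ᵥ v) a = 0 := by
      intro a
      rw [mulVec_eq_toBlock_add A K N v a, vK]
      erw [vN]
      rw [hy]; simp
    have he : energy A v = 0 := by
      rw [energy, dotProduct, sum_subtype_add_sum_subtype_not K]
      have h1 : ∀ a : {a // K a}, v a = 0 := fun a => congrFun vK a
      have h2 : ∀ a : {a // ¬ K a}, (A *ᵥ v) a = 0 := hAvN
      simp [h1, h2]
    have h0 := mulVec_eq_zero_of_energy_eq_zero hA he
    funext a
    have := mulVec_eq_toBlock_add A K K v a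
    rw [h0, vK] at this
    erw [vN] at this
    simpa using this.symm
  have hr : A.toBlock N N * pinv (A.toBlock N N) * A.toBlock N K = A.toBlock N K := by
    have := congrArg Matrix.transpose (mul_pinv_mul_of_ker_le hNN _ hker)
    simpa only [Matrix.transpose_mul, hNN, pinv_transpose hNN, hKN, Matrix.mul_assoc] using this
  set y : {a // N a} → ℝ := -((pinv (A.toBlock N N) * A.toBlock N K) *ᵥ x) with hy
  set g : n → ℝ := fun a => if h : K a then x ⟨a, h⟩ else y ⟨a, h⟩
  have gK : (fun b : {b // K b} => g b) = x := by
    funext b; simp [g, b.2]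
  have gN : (fun b : {b // ¬ K b} => g b) = y := by
    funext b
    have : ¬ K b := b.2
    simp [g, this]
  refine ⟨g, fun a => congrFun gK a, fun a => ?_, fun a ha => ?_⟩
  · rw [mulVec_eq_toBlock_add A K K g a, gK, gN, ← Pi.add_apply]
    rw [schur, Matrix.sub_mulVec, hy, Matrix.mulVec_neg, Matrix.mulVec_mulVec, ← sub_eq_add_neg,
      Matrix.mul_assoc]
  · have h := mulVec_eq_toBlock_add A K N g ⟨a, ha⟩
    rw [gK, gN] at h
    have e : A.toBlock N N *ᵥ y = -(A.toBlock N K *ᵥ x) := by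
      rw [hy, Matrix.mulVec_neg, Matrix.mulVec_mulVec, ← Matrix.mul_assoc, hr]
    have h' : (A *ᵥ g) a = (A.toBlock N K *ᵥ x) ⟨a, ha⟩ + (A.toBlock N N *ᵥ y) ⟨a, ha⟩ := h
    rw [h', e]
    simp

theorem energy_harmonic_extension {A : Matrix n n ℝ} {K : n → Prop} {x : {a // K a} → ℝ}
    {g : n → ℝ} (h1 : ∀ a : {a // K a}, g a = x a)
    (h2 : ∀ a : {a // K a}, (A *ᵥ g) a = (schur A K *ᵥ x) a)
    (h3 : ∀ a, ¬ K a → (A *ᵥ g) a = 0) : energy A g = energy (schur A K) x := by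
  have h3' : ∀ a : {a // ¬ K a}, (A *ᵥ g) a = 0 := fun a => h3 a a.2
  rw [energy, dotProduct, sum_subtype_add_sum_subtype_not K]
  simp [h1, h2, h3', energy, dotProduct]

/-- The energy of the Schur complement is attained by an extension. -/
theorem exists_energy_eq_energy_schur {A : Matrix n n ℝ} (hA : A.PosSemidef) (K : n → Prop)
    (x : {a // K a} → ℝ) :
    ∃ g : n → ℝ, (∀ a : {a // K a}, g a = x a) ∧ energy A g = energy (schur A K) x := by
  obtain ⟨g, h1, h2, h3⟩ := exists_harmonic_extension hA K x
  exact ⟨g, h1, energy_harmonic_extension h1 h2 h3⟩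

/-- The Schur complement has the least energy among all extensions. -/
theorem energy_schur_le {A : Matrix n n ℝ} (hA : A.PosSemidef) (K : n → Prop) (v : n → ℝ) :
    energy (schur A K) (fun a => v a) ≤ energy A v := by
  obtain ⟨g, h1, h2, h3⟩ := exists_harmonic_extension hA K fun a => v a
  rw [← energy_harmonic_extension h1 h2 h3]
  have hv : v = (v - g) + g := by simp
  rw [hv, energy_add (transpose_eq_of_isHermitian hA.1)]
  have h3' : ∀ a : {a // ¬ K a}, (A *ᵥ g) a = 0 := fun a => h3 a a.2
  have h0 : (v - g) ⬝ᵥ A *ᵥ g = 0 := by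
    rw [dotProduct, sum_subtype_add_sum_subtype_not K]
    simp [h1, h3']
  have := energy_nonneg hA (v - g)
  rw [h0]
  linarith

theorem posSemidef_schur {A : Matrix n n ℝ} (hA : A.PosSemidef) (K : n → Prop) :
    (schur A K).PosSemidef := by
  have hT := transpose_eq_of_isHermitian hA.1
  refine posSemidef_of_energy_nonneg ?_ fun x => ?_
  · have ht : ∀ L M : n → Prop, (A.toBlock L M)ᵀ = A.toBlock M L := by
      intro L M
      ext a b
      exact congrFun (congrFun hT a) b
    rw [schur, Matrix.transpose_sub, Matrix.transpose_mul, Matrix.transpose_mul, ht, ht, ht,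
      pinv_transpose (ht _ _), Matrix.mul_assoc]
  · obtain ⟨g, -, hg⟩ := exists_energy_eq_energy_schur hA K x
    exact hg ▸ energy_nonneg hA g

theorem mulVec_eq_zero_of_add_mulVec_eq_zero {A B : Matrix n n ℝ} (hA : A.PosSemidef)
    (hB : B.PosSemidef) {y : n → ℝ} (hy : (A + B) *ᵥ y = 0) : A *ᵥ y = 0 := by
  have h : energy A y + energy B y = 0 := by
    rw [← energy_matrix_add, energy, hy, dotProduct_zero]
  exact mulVec_eq_zero_of_energy_eq_zero hA
    (by linarith [energy_nonneg hA y, energy_nonneg hB y])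

theorem parallelSum_eq_left {A B : Matrix n n ℝ} (hA : A.PosSemidef) (hB : B.PosSemidef) :
    parallelSum A B = A - A * pinv (A + B) * A := by
  have hM := transpose_eq_of_isHermitian (hA.add hB).1
  have h := mul_pinv_mul_of_ker_le hM A fun y =>
    mulVec_eq_zero_of_add_mulVec_eq_zero hA hB
  have h' := congrArg Matrix.transpose h
  rw [Matrix.transpose_mul, Matrix.transpose_mul, hM, pinv_transpose hM,
    transpose_eq_of_isHermitian hA.1] at h'
  have e : parallelSum A B = (A + B) * (pinv (A + B) * A) - A * (pinv (A + B) * A) := by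
    rw [← Matrix.sub_mul, add_sub_cancel_left, parallelSum, Matrix.mul_assoc]
  rw [e, h', Matrix.mul_assoc]

theorem parallelSum_eq_right {A B : Matrix n n ℝ} (hA : A.PosSemidef) (hB : B.PosSemidef) :
    parallelSum A B = B - B * pinv (A + B) * B := by
  have hM := transpose_eq_of_isHermitian (hA.add hB).1
  have h := mul_pinv_mul_of_ker_le hM B fun y hy =>
    mulVec_eq_zero_of_add_mulVec_eq_zero hB hA (by rwa [add_comm])
  have e : parallelSum A B = B * pinv (A + B) * (A + B) - B * pinv (A + B) * B := by
    rw [← Matrix.mul_sub, add_sub_cancel_right, parallelSum]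
  rw [e, h]

theorem posSemidef_pinv {M : Matrix n n ℝ} (hM : M.PosSemidef) : (pinv M).PosSemidef := by
  have hT := transpose_eq_of_isHermitian hM.1
  have h := (isPseudoInverse_pinv hM.1).self_mul_mul
  have h' : (pinv M)ᵀ * M * pinv M = pinv M := by rw [pinv_transpose hT, h]
  refine posSemidef_of_energy_nonneg (pinv_transpose hT) fun x => ?_
  rw [← h', energy_transpose_mul_mul]
  exact energy_nonneg hM _

theorem energy_parallelSum_le_left {A B : Matrix n n ℝ} (hA : A.PosSemidef) (hB : B.PosSemidef)
    (x : n → ℝ) : energy (parallelSum A B) x ≤ energy A x := by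
  have h : energy A x = energy (parallelSum A B) x + energy (Aᵀ * pinv (A + B) * A) x := by
    rw [← energy_matrix_add, transpose_eq_of_isHermitian hA.1, parallelSum_eq_left hA hB,
      sub_add_cancel]
  rw [h, energy_transpose_mul_mul]
  linarith [energy_nonneg (posSemidef_pinv (hA.add hB)) (A *ᵥ x)]

theorem energy_parallelSum_le_right {A B : Matrix n n ℝ} (hA : A.PosSemidef) (hB : B.PosSemidef)
    (x : n → ℝ) : energy (parallelSum A B) x ≤ energy B x := by
  have h : energy B x = energy (parallelSum A B) x + energy (Bᵀ * pinv (A + B) * B) x := by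
    rw [← energy_matrix_add, transpose_eq_of_isHermitian hB.1, parallelSum_eq_right hA hB,
      sub_add_cancel]
  rw [h, energy_transpose_mul_mul]
  linarith [energy_nonneg (posSemidef_pinv (hA.add hB)) (B *ᵥ x)]

theorem posSemidef_parallelSum {A B : Matrix n n ℝ} (hA : A.PosSemidef) (hB : B.PosSemidef) :
    (parallelSum A B).PosSemidef := by
  have hM := transpose_eq_of_isHermitian (hA.add hB).1
  have hAT := transpose_eq_of_isHermitian hA.1
  refine posSemidef_of_energy_nonneg ?_ fun x => ?_
  · rw [parallelSum_eq_left hA hB, Matrix.transpose_sub, Matrix.transpose_mul,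
      Matrix.transpose_mul, pinv_transpose hM, hAT, Matrix.mul_assoc]
  · -- `x = (x - y) + y` is the splitting at which the infimal convolution is attained
    set y := (pinv (A + B) * A) *ᵥ x with hy
    have h1 : parallelSum A B *ᵥ x = B *ᵥ y := by
      rw [parallelSum, hy, Matrix.mulVec_mulVec, Matrix.mul_assoc]
    have h2 : parallelSum A B *ᵥ x = A *ᵥ (x - y) := by
      rw [parallelSum_eq_left hA hB, hy, Matrix.sub_mulVec, Matrix.mulVec_sub,
        Matrix.mulVec_mulVec, Matrix.mul_assoc]
    have e : energy (parallelSum A B) x = energy A (x - y) + energy B y := by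
      have hx : x ⬝ᵥ parallelSum A B *ᵥ x
          = (x - y) ⬝ᵥ parallelSum A B *ᵥ x + y ⬝ᵥ parallelSum A B *ᵥ x := by
        rw [← add_dotProduct, sub_add_cancel]
      rw [energy, hx]
      nth_rw 1 [h2]
      rw [h1]
      rfl
    rw [e]
    exact add_nonneg (energy_nonneg hA _) (energy_nonneg hB _)

theorem parallelSumList_spec (L : List (Matrix n n ℝ)) (hL : ∀ A ∈ L, A.PosSemidef) :
    (parallelSumList L).PosSemidef ∧
      ∀ A ∈ L, ∀ x, energy (parallelSumList L) x ≤ energy A x := by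
  induction L with
  | nil => exact ⟨Matrix.PosSemidef.zero, by simp⟩
  | cons A L ih =>
    cases L with
    | nil =>
      refine ⟨hL A (by simp), fun C hC x => ?_⟩
      rw [List.mem_singleton.1 hC, parallelSumList]
    | cons B L =>
      obtain ⟨ih1, ih2⟩ := ih fun C hC => hL C (List.mem_cons_of_mem _ hC)
      have hA := hL A (by simp)
      refine ⟨posSemidef_parallelSum hA ih1, fun C hC x => ?_⟩
      rcases List.mem_cons.1 hC with rfl | hC
      · exact energy_parallelSum_le_left hA ih1 x
      · exact (energy_parallelSum_le_right hA ih1 x).trans (ih2 C hC x)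

end Schur

/-! ### Eigenvector coordinates -/

namespace EigenBasis

variable {n : Type*} [Fintype n] {A B : Matrix n n ℝ} (E : EigenBasis A B)

/-- The matrix whose columns are the eigenvectors. -/
def mat : Matrix n n ℝ := Matrix.of fun x l => E.vec l x

/-- The reciprocal eigenvalue `1 / λ`, which is `0` for `λ = ∞`. -/
noncomputable def invVal (l : n) : ℝ := (E.val l)⁻¹.toReal

theorem invVal_nonneg (l : n) : 0 ≤ E.invVal l := ENNReal.toReal_nonneg

/-- The eigenvalue `0` does not occur, since `A v` is not zero for a normalized `v`. -/
theorem mulVec_vec (l : n) : B *ᵥ E.vec l = E.invVal l • A *ᵥ E.vec l := by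
  rcases E.eigen l with ⟨h, e⟩ | ⟨h, e⟩
  · have h0 : (E.val l).toReal ≠ 0 := by
      intro h0
      have := E.normalized l l
      rw [e, h0] at this
      simp at this
    rw [e, smul_smul, invVal, ENNReal.toReal_inv, inv_mul_cancel₀ h0, one_smul]
  · simp [e, invVal, h]

theorem transpose_mat_mul_mul_mat : E.matᵀ * A * E.mat = 1 := by
  ext k l
  have h := E.normalized l k
  rw [Matrix.mul_assoc, Matrix.one_apply]
  rw [dotProduct_comm] at h
  exact h.trans (if_congr eq_comm rfl rfl)

theorem transpose_mat_mul_right_mul_mat : E.matᵀ * B * E.mat = Matrix.diagonal E.invVal := by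
  ext k l
  have h := E.normalized l k
  have h1 : (E.matᵀ * B * E.mat) k l = E.vec k ⬝ᵥ B *ᵥ E.vec l := by
    rw [Matrix.mul_assoc]; rfl
  rw [h1, E.mulVec_vec, dotProduct_smul, dotProduct_comm, h, Matrix.diagonal_apply]
  by_cases hkl : k = l
  · simp [hkl]
  · simp [hkl, Ne.symm hkl]

theorem isUnit_mat : IsUnit E.mat :=
  (Matrix.isUnit_iff_isUnit_det _).2 (Matrix.isUnit_det_of_left_inverse
    E.transpose_mat_mul_mul_mat)

theorem energy_mat_mulVec (α : n → ℝ) : energy A (E.mat *ᵥ α) = ∑ l, α l ^ 2 := by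
  rw [← energy_transpose_mul_mul, transpose_mat_mul_mul_mat, energy, Matrix.one_mulVec, dotProduct]
  exact Finset.sum_congr rfl fun l _ => (sq _).symm

theorem energy_right_mat_mulVec (α : n → ℝ) :
    energy B (E.mat *ᵥ α) = ∑ l, E.invVal l * α l ^ 2 := by
  rw [← energy_transpose_mul_mul, transpose_mat_mul_right_mul_mat, energy, dotProduct]
  refine Finset.sum_congr rfl fun l _ => ?_
  rw [Matrix.mulVec_diagonal]
  ring

theorem one_le_mul_invVal {t : ℝ} {l : n} (ht : 0 < t) (h : E.val l ≤ ENNReal.ofReal t) :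
    1 ≤ t * E.invVal l := by
  have htop : E.val l ≠ ∞ := ne_top_of_le_ne_top ENNReal.ofReal_ne_top h
  have h0 : E.val l ≠ 0 := by
    intro h0
    rcases E.eigen l with ⟨-, e⟩ | ⟨h', -⟩
    · have := E.normalized l l
      rw [e, h0] at this
      simp at this
    · exact htop h'
  have hpos : 0 < (E.val l).toReal := ENNReal.toReal_pos h0 htop
  have hle : (E.val l).toReal ≤ t := ENNReal.toReal_le_of_le_ofReal ht.le h
  rw [invVal, ENNReal.toReal_inv, ← div_eq_mul_inv, one_le_div hpos]
  exact hle

/-- If `β` keeps only coefficients of `α` that belong to eigenvalues `≤ t`, then the `A`-energy of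
the combination `β` is controlled by the `B`-energy of the combination `α`. -/
theorem energy_mat_mulVec_le {t : ℝ} (ht : 0 < t) {α β : n → ℝ}
    (h : ∀ l, β l = 0 ∨ β l = α l ∧ E.val l ≤ ENNReal.ofReal t) :
    energy A (E.mat *ᵥ β) ≤ t * energy B (E.mat *ᵥ α) := by
  rw [energy_mat_mulVec, energy_right_mat_mulVec, Finset.mul_sum]
  refine Finset.sum_le_sum fun l _ => ?_
  rcases h l with h | ⟨h, hl⟩
  · rw [h]
    have := mul_nonneg ht.le (mul_nonneg (E.invVal_nonneg l) (sq_nonneg (α l)))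
    simpa using this
  · rw [h]
    nlinarith [E.one_le_mul_invVal ht hl, sq_nonneg (α l)]

end EigenBasis

/-! ### Coercivity of the finite element form -/

namespace Problem

variable {d N : ℕ} {ι τ : Type*} (P : Problem d N ι τ)

/-- The integral of the coefficient over an element. -/
noncomputable def weight (T : τ) : ℝ := ∫ x in P.simplex T, P.ρ x

theorem isCompact_simplex (T : τ) : IsCompact (P.simplex T) :=
  ((Set.finite_range (P.vert T)).image P.pos).isCompact_convexHull ℝ

theorem pos_mem_simplex (T : τ) (j : Fin (d + 1)) : P.pos (P.vert T j) ∈ P.simplex T :=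
  subset_convexHull ℝ _ ⟨_, ⟨j, rfl⟩, rfl⟩

theorem volume_simplex_pos (T : τ) : 0 < MeasureTheory.volume (P.simplex T) := by
  have h1 : (interior (P.simplex T)).Nonempty := by
    rw [simplex, interior_convexHull_nonempty_iff_affineSpan_eq_top, ← Set.range_comp]
    refine (P.affineIndependent T).affineSpan_eq_top_iff_card_eq_finrank_add_one.2 ?_
    simp
  exact (isOpen_interior.measure_pos _ h1).trans_le (MeasureTheory.measure_mono interior_subset)

theorem weight_pos (T : τ) : 0 < P.weight T := by
  have h0 := P.ρ_pos T
  refine (MeasureTheory.setIntegral_pos_iff_support_of_nonneg_ae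
    (h0.mono fun x hx => hx.le) (P.ρ_integrable T)).2 ?_
  have hm : MeasurableSet (P.simplex T) := (P.isCompact_simplex T).measurableSet
  have h1 : P.simplex T ≤ᵐ[MeasureTheory.volume]
      (Function.support P.ρ ∩ P.simplex T : Set (EuclideanSpace ℝ (Fin d))) := by
    filter_upwards [(MeasureTheory.ae_restrict_iff' hm).1 h0] with x hx hxT
    exact ⟨(hx hxT).ne', hxT⟩
  exact (P.volume_simplex_pos T).trans_le (MeasureTheory.measure_mono_ae h1)

theorem isUnit_edgeMatrix (T : τ) : IsUnit (P.edgeMatrix T) := by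
  rw [← Matrix.linearIndependent_rows_iff_isUnit]
  have h := (affineIndependent_iff_linearIndependent_vsub ℝ _ 0).1 (P.affineIndependent T)
  have h2 := h.comp (fun k : Fin d => ⟨k.succ, Fin.succ_ne_zero k⟩) fun a b hab => by
    simpa using hab
  exact h2.map' (WithLp.linearEquiv 2 ℝ (Fin d → ℝ)).toLinearMap (LinearEquiv.ker _)

theorem grad_add (T : τ) (u v : ι → ℝ) : P.grad T (u + v) = P.grad T u + P.grad T v := by
  rw [grad, grad, grad, ← Matrix.mulVec_add]
  congr 1
  funext k
  simp only [Pi.add_apply]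
  ring

theorem grad_smul (T : τ) (t : ℝ) (u : ι → ℝ) : P.grad T (t • u) = t • P.grad T u := by
  rw [grad, grad, ← Matrix.mulVec_smul]
  congr 1
  funext k
  simp only [Pi.smul_apply, smul_eq_mul]
  ring

theorem grad_sum_smul {κ : Type*} [Fintype κ] (T : τ) (c : κ → ℝ) (u : κ → ι → ℝ) :
    P.grad T (∑ k, c k • u k) = ∑ k, c k • P.grad T (u k) := by
  let L : (ι → ℝ) →ₗ[ℝ] (Fin d → ℝ) :=
    { toFun := P.grad T, map_add' := P.grad_add T, map_smul' := P.grad_smul T }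
  refine (map_sum L (fun k => c k • u k) Finset.univ).trans ?_
  exact Finset.sum_congr rfl fun k _ => L.map_smul _ _

theorem eq_of_grad_eq_zero {T : τ} {u : ι → ℝ} (h : P.grad T u = 0) (j : Fin (d + 1)) :
    u (P.vert T j) = u (P.vert T 0) := by
  have hu := (Matrix.isUnit_iff_isUnit_det _).1 (P.isUnit_edgeMatrix T)
  have h1 : (fun k : Fin d => u (P.vert T k.succ) - u (P.vert T 0)) = 0 := by
    have := congrArg (P.edgeMatrix T *ᵥ ·) h
    simpa [grad, Matrix.mulVec_mulVec, Matrix.mul_nonsing_inv _ hu] using this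
  refine Fin.cases rfl (fun k => ?_) j
  exact sub_eq_zero.1 (congrFun h1 k)

theorem grad_congr {T : τ} {u v : ι → ℝ} (h : ∀ j, u (P.vert T j) = v (P.vert T j)) :
    P.grad T u = P.grad T v := by
  simp only [grad, h]

variable [Fintype τ]

theorem form_eq (i : Fin N) (u v : ι → ℝ) :
    P.form i u v = ∑ T ∈ Finset.univ.filter (fun T => P.sub T = i),
      P.weight T * (P.grad T u ⬝ᵥ P.grad T v) := by
  refine Finset.sum_congr rfl fun T _ => ?_
  rw [MeasureTheory.integral_mul_const, weight]

theorem grad_eq_zero_of_form_eq_zero {i : Fin N} {u : ι → ℝ} (h : P.form i u u = 0) {T : τ}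
    (hT : P.sub T = i) : P.grad T u = 0 := by
  have hnn : ∀ T, 0 ≤ P.weight T * (P.grad T u ⬝ᵥ P.grad T u) := fun T =>
    mul_nonneg (P.weight_pos T).le (Finset.sum_nonneg fun k _ => mul_self_nonneg _)
  rw [form_eq, Finset.sum_eq_zero_iff_of_nonneg fun T _ => hnn T] at h
  have := h T (by simp [hT])
  exact dotProduct_self_eq_zero.1 ((mul_eq_zero.1 this).resolve_left (P.weight_pos T).ne')

theorem mem_shared_vert (T : τ) (j : Fin (d + 1)) : P.sub T ∈ P.shared (P.vert T j) := by
  simp only [shared, Finset.mem_filter, Finset.mem_univ, true_and]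
  exact ⟨T, rfl, j, rfl⟩

theorem isClosed_iUnion_simplex (p : τ → Prop) :
    IsClosed (⋃ T ∈ {T | p T}, P.simplex T) :=
  (Set.toFinite _).isClosed_biUnion fun T _ => (P.isCompact_simplex T).isClosed

/-- A piecewise linear function that is constant on every element and vanishes at the boundary
nodes is zero: on the set where it equals a constant `c`, a node with the largest first coordinate
is a boundary node, because elements that meet share a node. -/
theorem eq_zero_of_grad_eq_zero [Fintype ι] (hd : 0 < d) {f : ι → ℝ}
    (hf : ∀ x, P.OnBoundary x → f x = 0) (hg : ∀ T, P.grad T f = 0) : f = 0 := by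
  by_contra hne
  obtain ⟨x₀, hx₀⟩ := Function.ne_iff.1 hne
  set c := f x₀ with hc
  have hc0 : c ≠ 0 := hx₀
  obtain ⟨x, hxc, hxmax⟩ := (Finset.univ.filter fun x => f x = c).exists_max_image
    (fun x => P.pos x ⟨0, hd⟩) ⟨x₀, by simp [hc]⟩
  have hfx : f x = c := by simpa using hxc
  have hmax : ∀ y, f y = c → P.pos y ⟨0, hd⟩ ≤ P.pos x ⟨0, hd⟩ := fun y hy =>
    hxmax y (by simp [hy])
  have hconst : ∀ T j k, f (P.vert T j) = f (P.vert T k) := fun T j k =>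
    (P.eq_of_grad_eq_zero (hg T) j).trans (P.eq_of_grad_eq_zero (hg T) k).symm
  obtain ⟨T, j, hj⟩ := P.node_mem x
  refine hc0 (hfx ▸ hf x ⟨subset_closure ?_, fun hint => ?_⟩)
  · exact Set.mem_iUnion.2 ⟨T, hj ▸ P.pos_mem_simplex T j⟩
  -- the elements with another value stay away from `x`
  set O : Set (EuclideanSpace ℝ (Fin d)) := ⋃ T' ∈ {T' | f (P.vert T' 0) ≠ c}, P.simplex T'
  have hO : P.pos x ∉ O := by
    intro hx
    obtain ⟨T', hT', hxT'⟩ := Set.mem_iUnion₂.1 hx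
    have h1 : P.pos x ∈ P.simplex T ∩ P.simplex T' := ⟨hj ▸ P.pos_mem_simplex T j, hxT'⟩
    rw [simplex, simplex, P.conforming] at h1
    obtain ⟨_, y, ⟨⟨k, rfl⟩, ⟨k', hk'⟩⟩, -⟩ := convexHull_nonempty_iff.1 ⟨_, h1⟩
    refine hT' ?_
    rw [hconst T' 0 k', hk', hconst T k j, hj, hfx]
  have hnear : ∀ᶠ y in nhds (P.pos x), y ∈ P.closedDomain ∧ y ∉ O :=
    Filter.Eventually.and (mem_interior_iff_mem_nhds.1 hint)
      ((P.isClosed_iUnion_simplex _).isOpen_compl.mem_nhds hO)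
  set e : EuclideanSpace ℝ (Fin d) := EuclideanSpace.single ⟨0, hd⟩ 1
  have htend : Filter.Tendsto (fun t : ℝ => P.pos x + t • e) (nhdsWithin 0 (Set.Ioi 0))
      (nhds (P.pos x)) := by
    have : Continuous fun t : ℝ => P.pos x + t • e := by fun_prop
    simpa using (this.tendsto 0).mono_left (nhdsWithin_le_nhds (s := Set.Ioi 0))
  obtain ⟨t, ⟨ht, hO'⟩, htpos⟩ := ((htend.eventually hnear).and self_mem_nhdsWithin).exists
  obtain ⟨T', hT'⟩ := Set.mem_iUnion.1 ht
  have hc' : f (P.vert T' 0) = c := by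
    by_contra h
    exact hO' (Set.mem_iUnion₂.2 ⟨T', h, hT'⟩)
  have hhalf : P.simplex T' ⊆ {y | y ⟨0, hd⟩ ≤ P.pos x ⟨0, hd⟩} := by
    refine convexHull_min ?_ (convex_halfSpace_le
      (EuclideanSpace.proj (𝕜 := ℝ) (⟨0, hd⟩ : Fin d)).toLinearMap.isLinear _)
    rintro _ ⟨_, ⟨k, rfl⟩, rfl⟩
    exact hmax _ ((hconst T' k 0).trans hc')
  have h1 := hhalf hT'
  have h2 : (0 : ℝ) < t := htpos
  simp [e] at h1
  linarith

variable [Fintype ι]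

/-- Extension by zero of a function on the unknowns of a subdomain. -/
noncomputable def extend (i : Fin N) (x : P.X i → ℝ) (y : ι) : ℝ :=
  if h : ¬ P.OnBoundary y ∧ i ∈ P.shared y then x ⟨y, h⟩ else 0

theorem extend_eq_sum (i : Fin N) (x : P.X i → ℝ) :
    P.extend i x = ∑ a, x a • (Pi.single a.1 1 : ι → ℝ) := by
  funext y
  rw [Finset.sum_apply, extend]
  split_ifs with h
  · rw [Finset.sum_eq_single_of_mem ⟨y, h⟩ (Finset.mem_univ _)]
    · simp
    · intro b _ hb
      have : y ≠ b.1 := fun e => hb (Subtype.ext e.symm)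
      simp [this]
  · symm
    refine Finset.sum_eq_zero fun b _ => ?_
    have : y ≠ b.1 := fun e => h (e ▸ b.2)
    simp [this]

theorem energy_stiffness (i : Fin N) (x : P.X i → ℝ) :
    energy (P.stiffness i) x = P.form i (P.extend i x) (P.extend i x) := by
  have h : ∀ T, P.grad T (P.extend i x) = ∑ a, x a • P.grad T (Pi.single a.1 1) := fun T => by
    rw [extend_eq_sum, grad_sum_smul]
  have e : energy (P.stiffness i) x = ∑ a, ∑ b, x a * (P.stiffness i a b * x b) := by
    simp only [energy, dotProduct, Matrix.mulVec, Finset.mul_sum]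
  rw [e, form_eq]
  simp only [h, stiffness, Matrix.of_apply, form_eq, sum_dotProduct, dotProduct_sum,
    smul_dotProduct, dotProduct_smul, smul_eq_mul, Finset.mul_sum, Finset.sum_mul]
  conv_rhs => rw [Finset.sum_comm]
  refine Finset.sum_congr rfl fun a _ => ?_
  conv_rhs => rw [Finset.sum_comm]
  refine Finset.sum_congr rfl fun b _ => Finset.sum_congr rfl fun T _ => ?_
  rw [dotProduct_comm]
  ring

theorem posSemidef_stiffness (i : Fin N) : (P.stiffness i).PosSemidef := by
  refine posSemidef_of_energy_nonneg ?_ fun x => ?_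
  · ext a b
    simp only [Matrix.transpose_apply, stiffness, Matrix.of_apply, form_eq]
    exact Finset.sum_congr rfl fun T _ => by rw [dotProduct_comm]
  · rw [energy_stiffness, form_eq]
    exact Finset.sum_nonneg fun T _ =>
      mul_nonneg (P.weight_pos T).le (Finset.sum_nonneg fun k _ => mul_self_nonneg _)

theorem posSemidef_S (i : Fin N) : (P.S i).PosSemidef :=
  posSemidef_schur (P.posSemidef_stiffness i) _

/-- The interface energy is definite on the fully coupled space. -/
theorem eq_zero_of_energy_S_eq_zero (hd : 0 < d) {u : P.Γ → ℝ}
    (hu : ∀ i, energy (P.S i) (fun a => u (P.toΓ i a)) = 0) : u = 0 := by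
  choose g hg he using fun i => exists_energy_eq_energy_schur (P.posSemidef_stiffness i)
    (fun a => 2 ≤ (P.shared a.1).card) (fun a => u (P.toΓ i a))
  -- the harmonic extensions fit together to a function of `V_h`
  let f : ι → ℝ := fun x =>
    if hb : P.OnBoundary x then 0
    else if h2 : 2 ≤ (P.shared x).card then u ⟨x, hb, h2⟩
    else if hs : ∃ i, i ∈ P.shared x then g hs.choose ⟨x, hb, hs.choose_spec⟩ else 0
  have hf : ∀ i x, i ∈ P.shared x → f x = P.extend i (g i) x := by
    intro i x hi
    by_cases hb : P.OnBoundary x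
    · simp [f, extend, hb]
    by_cases h2 : 2 ≤ (P.shared x).card
    · simp only [f, extend, hb, h2, hi, not_false_eq_true, and_self, dite_true, dite_false]
      exact (hg i ⟨⟨x, hb, hi⟩, h2⟩).symm
    · have hs : ∃ i, i ∈ P.shared x := ⟨i, hi⟩
      have e : hs.choose = i :=
        Finset.card_le_one.1 (by omega) _ hs.choose_spec _ hi
      simp only [f, extend, hb, h2, hi, hs, not_false_eq_true, and_self, dite_true, dite_false]
      congr!
  have hgrad : ∀ T, P.grad T f = 0 := by
    intro T
    rw [P.grad_congr fun j => hf (P.sub T) _ (P.mem_shared_vert T j)]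
    refine P.grad_eq_zero_of_form_eq_zero (i := P.sub T) ?_ rfl
    rw [← energy_stiffness, he]
    convert hu (P.sub T)
    rfl
  have h0 := P.eq_zero_of_grad_eq_zero hd (f := f) (fun x hx => by simp [f, hx]) hgrad
  funext x
  have := congrFun h0 x.1
  simpa [f, x.2.1, x.2.2] using this

end Problem

/-! ### The jump operator on one class, and summation over the classes -/

section Jump

/-- The local energies of the jumps `V_m - ∑ D_l V_l` are bounded by the energies of the `V_m` with
respect to `∑_m ∑_{l ≠ m} D_lᵀ S_m D_l`. The jump of `m` is `∑_{l ≠ m} D_l (V_m - V_l)`, so the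
pair `(m, l)` of the double sum is used once for `V_m` and once for `V_l`; hence every pair is
used at most once for every vector. -/
theorem sum_energy_jump_le {κ n : Type*} [Fintype κ] [Fintype n] [DecidableEq κ] [DecidableEq n]
    {D S : κ → Matrix n n ℝ}
    (hD : ∑ l, D l = 1) (hS : ∀ m, (S m).PosSemidef) (V : κ → n → ℝ) :
    ∑ m, energy (S m) (V m - ∑ l, D l *ᵥ V l) ≤ 2 * ((Fintype.card κ : ℝ) - 1) *
      ∑ k, energy (∑ m, ∑ l ∈ Finset.univ.erase m, (D l)ᵀ * S m * D l) (V k) := by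
  set e : κ → κ → κ → ℝ := fun m l k => energy (S m) (D l *ᵥ V k)
  have he : ∀ m l k, 0 ≤ e m l k := fun m l k => energy_nonneg (hS m) _
  have h1 : ∀ m, energy (S m) (V m - ∑ l, D l *ᵥ V l) ≤ ((Fintype.card κ : ℝ) - 1) *
      ∑ l ∈ Finset.univ.erase m, 2 * ∑ k, e m l k := by
    intro m
    have hz : V m - ∑ l, D l *ᵥ V l =
        ∑ l ∈ Finset.univ.erase m, (D l *ᵥ V m - D l *ᵥ V l) := by
      rw [Finset.sum_erase _ (by simp), Finset.sum_sub_distrib, ← Matrix.sum_mulVec, hD,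
        Matrix.one_mulVec]
    have hc : ((Finset.univ.erase m).card : ℝ) = (Fintype.card κ : ℝ) - 1 := by
      rw [Finset.card_erase_of_mem (Finset.mem_univ m), Finset.card_univ,
        Nat.cast_pred (Fintype.card_pos_iff.2 ⟨m⟩)]
    rw [hz]
    refine (energy_sum_le (hS m) _ _).trans ?_
    rw [hc]
    have hc0 : (0 : ℝ) ≤ (Fintype.card κ : ℝ) - 1 := hc ▸ Nat.cast_nonneg _
    refine mul_le_mul_of_nonneg_left (Finset.sum_le_sum fun l hl => ?_) hc0
    refine (energy_sub_le (hS m) _ _).trans ?_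
    have hml : m ≠ l := (Finset.ne_of_mem_erase hl).symm
    have : e m l m + e m l l ≤ ∑ k, e m l k := by
      rw [← Finset.sum_pair hml]
      exact Finset.sum_le_univ_sum_of_nonneg fun k => he m l k
    simp only [e] at this ⊢
    linarith
  have h2 : ∀ k, energy (∑ m, ∑ l ∈ Finset.univ.erase m, (D l)ᵀ * S m * D l) (V k) =
      ∑ m, ∑ l ∈ Finset.univ.erase m, e m l k := fun k => by
    simp only [energy_matrix_sum, energy_transpose_mul_mul, e]
  refine (Finset.sum_le_sum fun m _ => h1 m).trans (le_of_eq ?_)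
  simp only [h2]
  rw [Finset.sum_comm, ← Finset.mul_sum, mul_comm (2 : ℝ), mul_assoc]
  congr 1
  rw [Finset.mul_sum]
  refine Finset.sum_congr rfl fun m _ => ?_
  rw [Finset.sum_comm, Finset.mul_sum]

/-- A weighted double count. The class `c` belongs to the subdomains `i ∈ J c`, and `F i` is the set
of the classes of `i`. The weight `|F i|` of the left side belongs to one subdomain of `c`, while
the number of terms that a fixed `ε m` receives is `|F m|` for another subdomain `m` of `c`; the
product `|F i| |F m|` is at most the larger of the two squares. -/
theorem sum_card_mul_sum_le {κ ν : Type*} [Fintype κ] [Fintype ν] (p : κ → Prop)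
    (J : κ → Finset ν) (g : κ → ν → ℝ) (ε : ν → ℝ) (b : κ → ℝ) {K : ℝ} (F : ν → Finset κ)
    (hF : ∀ i c, c ∈ F i ↔ p c ∧ i ∈ J c) (hε : ∀ i, 0 ≤ ε i) (hg : ∀ c i, 0 ≤ g c i)
    (hb : ∀ c, p c → 0 ≤ b c) (hgb : ∀ c, p c → ∑ i ∈ J c, g c i ≤ b c * ∑ i ∈ J c, ε i)
    (hK0 : 0 ≤ K) (hK : ∀ i, ∀ c ∈ F i, ((F i).card : ℝ) ^ 2 * b c ≤ K) :
    ∑ i, ((F i).card : ℝ) * ∑ c ∈ F i, g c i ≤ K * ∑ i, ε i := by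
  set M : κ → ℕ := fun c => (J c).sup fun i => (F i).card
  have swap : ∀ f : κ → ν → ℝ, ∑ i, ∑ c ∈ F i, f c i =
      ∑ c ∈ Finset.univ.filter p, ∑ i ∈ J c, f c i := fun f =>
    Finset.sum_comm' fun i c => by simp [hF, and_comm]
  have hMK : ∀ m, ∀ c ∈ F m, ((F m).card : ℝ) * (M c * b c) ≤ K := by
    intro m c hc
    obtain ⟨hp, hm⟩ := (hF m c).1 hc
    obtain ⟨i, hi, hMi⟩ := Finset.exists_mem_eq_sup (J c) ⟨m, hm⟩ fun i => (F i).card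
    have hMi' : M c = (F i).card := hMi
    have hle : (F m).card ≤ M c := Finset.le_sup (f := fun i => (F i).card) hm
    have hle' : ((F m).card : ℝ) ≤ M c := by exact_mod_cast hle
    refine le_trans ?_ (hK i c ((hF i c).2 ⟨hp, hi⟩))
    rw [← hMi', sq, ← mul_assoc]
    exact mul_le_mul_of_nonneg_right
      (mul_le_mul_of_nonneg_right hle' (Nat.cast_nonneg _)) (hb c hp)
  calc ∑ i, ((F i).card : ℝ) * ∑ c ∈ F i, g c i
      = ∑ c ∈ Finset.univ.filter p, ∑ i ∈ J c, ((F i).card : ℝ) * g c i := by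
        simp only [Finset.mul_sum]
        exact swap fun c i => ((F i).card : ℝ) * g c i
    _ ≤ ∑ c ∈ Finset.univ.filter p, ∑ i ∈ J c, M c * b c * ε i := by
        refine Finset.sum_le_sum fun c hc => ?_
        have hp : p c := (Finset.mem_filter.1 hc).2
        calc ∑ i ∈ J c, ((F i).card : ℝ) * g c i ≤ ∑ i ∈ J c, (M c : ℝ) * g c i :=
              Finset.sum_le_sum fun i hi => mul_le_mul_of_nonneg_right
                (by exact_mod_cast Finset.le_sup (f := fun i => (F i).card) hi) (hg c i)
          _ = M c * ∑ i ∈ J c, g c i := by rw [Finset.mul_sum]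
          _ ≤ M c * (b c * ∑ i ∈ J c, ε i) :=
              mul_le_mul_of_nonneg_left (hgb c hp) (Nat.cast_nonneg _)
          _ = ∑ i ∈ J c, M c * b c * ε i := by rw [← mul_assoc, Finset.mul_sum]
    _ = ∑ m, ∑ c ∈ F m, M c * b c * ε m := (swap fun c i => M c * b c * ε i).symm
    _ ≤ ∑ m, K * ε m := by
        refine Finset.sum_le_sum fun m _ => ?_
        rw [← Finset.sum_mul]
        refine mul_le_mul_of_nonneg_right ?_ (hε m)
        rcases (F m).eq_empty_or_nonempty with h0 | h0
        · rw [h0, Finset.sum_empty]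
          exact hK0
        · have hpos : (0 : ℝ) < (F m).card := by exact_mod_cast h0.card_pos
          have := Finset.sum_le_card_nsmul (F m) (fun c => (M c : ℝ) * b c) (K / (F m).card)
            fun c hc => by
              rw [le_div_iff₀ hpos, mul_comm]
              exact hMK m c hc
          rwa [nsmul_eq_mul, mul_div_cancel₀ _ hpos.ne'] at this
    _ = K * ∑ i, ε i := by rw [Finset.mul_sum]

end Jump

/-! ### The spectrum of a two-space preconditioned operator -/

section Precond

variable {v w : Type*} [Fintype v] [Fintype w] {S D : Matrix w w ℝ} {R : Matrix w v ℝ}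

theorem posDef_transpose_mul_mul_of_leftInverse (hS : S.PosDef) {C : Matrix v w ℝ}
    (h : ∀ u, C *ᵥ R *ᵥ u = u) :
    (Rᵀ * S * R).PosDef := by
  rw [← Matrix.conjTranspose_eq_transpose_of_trivial]
  refine hS.conjTranspose_mul_mul_same fun x y hxy => ?_
  have := congrArg (C *ᵥ ·) hxy
  simpa only [h] using this

variable [DecidableEq w]

theorem posDef_precond (hS : S.PosDef) (hR : ∀ u, (Rᵀ * D) *ᵥ R *ᵥ u = u) :
    (Rᵀ * D * S⁻¹ * Dᵀ * R).PosDef := by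
  have hR : Rᵀ * D * R = 1 := Matrix.ext_of_mulVec_single fun i => by
    rw [← Matrix.mulVec_mulVec, hR, Matrix.one_mulVec]
  have h := congrArg Matrix.transpose hR
  simp only [Matrix.transpose_mul, Matrix.transpose_transpose, Matrix.transpose_one] at h
  have := posDef_transpose_mul_mul_of_leftInverse (R := Dᵀ * R) hS.inv (C := Rᵀ) fun u => by
    rw [Matrix.mulVec_mulVec, ← Matrix.mul_assoc, Matrix.mul_assoc, h, Matrix.one_mulVec]
  simpa only [Matrix.transpose_mul, Matrix.transpose_transpose, Matrix.mul_assoc] using this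

/-- With the averaging projection `E = R Rᵀ D`, an eigenpair `λ, u` gives `x = R u` and
`y = S⁻¹ Dᵀ R Rᵀ S R u` such that `E y = λ x`, `E x = x`, `⟨x, y⟩ = |x|²` and `|y|² = λ |x|²` in the
energy of `S`. The lower bound is `|x - y|² ≥ 0`. The upper bound is the jump estimate for
`x - y`, whose jump is `λ x - y`. -/
theorem mem_Icc_of_mem_spectrum (hS : S.PosDef) (hR : ∀ u, (Rᵀ * D) *ᵥ R *ᵥ u = u) {K : ℝ} (hK1 : 1 ≤ K)
    (hK : ∀ z, energy S (z - R *ᵥ (Rᵀ * D) *ᵥ z) ≤ K * energy S z) {t : ℝ}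
    (ht : t ∈ spectrum ℝ (Rᵀ * D * S⁻¹ * Dᵀ * R * (Rᵀ * S * R))) : t ∈ Set.Icc 1 K := by
  rw [← Matrix.spectrum_toLin', ← Module.End.hasEigenvalue_iff_mem_spectrum] at ht
  obtain ⟨u, hu⟩ := ht.exists_hasEigenvector
  have hu0 := hu.2
  have hT : (Rᵀ * D * S⁻¹ * Dᵀ * R * (Rᵀ * S * R)) *ᵥ u = t • u := by
    exact (Matrix.toLin'_apply _ _).symm.trans hu.apply_eq_smul
  have hST := transpose_eq_of_isHermitian hS.1
  have hSu : IsUnit S.det := (Matrix.isUnit_iff_isUnit_det _).1 hS.isUnit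
  set x := R *ᵥ u with hx
  set y := (S⁻¹ * Dᵀ * R * (Rᵀ * S * R)) *ᵥ u with hy
  have hDy : (Rᵀ * D) *ᵥ y = t • u := by
    rw [← hT, hy, Matrix.mulVec_mulVec]
    simp only [Matrix.mul_assoc]
  have hDx : (Rᵀ * D) *ᵥ x = u := hR u
  have hSy : S *ᵥ y = (Rᵀ * D)ᵀ *ᵥ (Rᵀ * S * R) *ᵥ u := by
    rw [hy, Matrix.mulVec_mulVec, Matrix.mulVec_mulVec, Matrix.transpose_mul,
      Matrix.transpose_transpose]
    congr 1
    simp only [← Matrix.mul_assoc]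
    rw [Matrix.mul_nonsing_inv _ hSu, Matrix.one_mul]
  have hadj : ∀ z, z ⬝ᵥ S *ᵥ y = ((Rᵀ * D) *ᵥ z) ⬝ᵥ (Rᵀ * S * R) *ᵥ u := fun z => by
    rw [hSy, Matrix.dotProduct_mulVec z, Matrix.vecMul_transpose]
  have ha : u ⬝ᵥ (Rᵀ * S * R) *ᵥ u = energy S x := energy_transpose_mul_mul S R u
  have hxy : x ⬝ᵥ S *ᵥ y = energy S x := by rw [hadj, hDx, ha]
  have hyy : energy S y = t * energy S x := by
    rw [energy, hadj, hDy, smul_dotProduct, ha, smul_eq_mul]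
  have hpos : 0 < energy S x := by
    have := (posDef_transpose_mul_mul_of_leftInverse hS hR).dotProduct_mulVec_pos hu0
    rw [star_trivial, ha] at this
    exact this
  have h1 : 1 ≤ t := by
    have h := energy_nonneg hS.posSemidef (x - y)
    rw [energy_sub hST, hxy, hyy] at h
    nlinarith
  refine ⟨h1, ?_⟩
  rcases h1.eq_or_lt with rfl | h1
  · exact hK1
  have h := hK (x - y)
  have e : (x - y) - R *ᵥ (Rᵀ * D) *ᵥ (x - y) = t • x - y := by
    rw [Matrix.mulVec_sub, hDx, hDy, Matrix.mulVec_sub, Matrix.mulVec_smul]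
    abel
  rw [e, energy_sub hST, energy_sub hST, energy_smul, smul_dotProduct, hxy, hyy, smul_eq_mul] at h
  have h' : (t - 1) * energy S x * t ≤ (t - 1) * energy S x * K := by linarith
  exact le_of_mul_le_mul_left h' (mul_pos (by linarith) hpos)

theorem condNumber_le {n : Type*} [Fintype n] {T : Matrix n n ℝ} {K : ℝ} (hK : 0 ≤ K)
    (h : spectrum ℝ T ⊆ Set.Icc 1 K) : condNumber T ≤ K := by
  rw [condNumber]
  rcases (spectrum ℝ T).eq_empty_or_nonempty with h0 | h0
  · simpa [h0] using hK
  · have h1 : sSup (spectrum ℝ T) ≤ K := csSup_le h0 fun t ht => (h ht).2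
    have h2 : 1 ≤ sInf (spectrum ℝ T) := le_csInf h0 fun t ht => (h ht).1
    exact (div_le_iff₀ (by linarith)).2 (h1.trans (le_mul_of_one_le_right hK h2))

end Precond

/-! ### Restriction to classes -/

theorem sum_extend_mul {m n : Type*} [Fintype m] [Fintype n] {f : m → n}
    (hf : Function.Injective f) (y : m → ℝ) (g : n → ℝ) :
    ∑ b, Function.extend f y 0 b * g b = ∑ x, y x * g (f x) := by
  symm
  refine Finset.sum_of_injOn f hf.injOn (by simp) (fun b _ hb => ?_) fun x _ => ?_
  · rw [Function.extend_apply' _ _ _ fun ⟨x, hx⟩ => hb ⟨x, by simp, hx⟩]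
    simp
  · rw [hf.extend_apply]

theorem energy_submatrix {m n : Type*} [Fintype m] [Fintype n] {f : m → n}
    (hf : Function.Injective f) (A : Matrix n n ℝ) (y : m → ℝ) :
    energy (A.submatrix f f) y = energy A (Function.extend f y 0) := by
  rw [energy, energy, dotProduct, dotProduct, sum_extend_mul hf]
  refine Finset.sum_congr rfl fun x _ => ?_
  congr 1
  simp only [Matrix.mulVec, dotProduct]
  simp only [mul_comm (A _ _), sum_extend_mul hf]
  exact Finset.sum_congr rfl fun z _ => mul_comm _ _

theorem energy_submatrix_subtype {m n : Type*} [Fintype m] [Fintype n] {f : m → n}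
    (hf : Function.Injective f) {K : n → Prop} (hK : ∀ x, K (f x))
    (hsurj : ∀ a, K a → ∃ x, f x = a) (A : Matrix {a // K a} {a // K a} ℝ) (v : n → ℝ) :
    energy (A.submatrix (fun x => ⟨f x, hK x⟩) fun x => ⟨f x, hK x⟩) (fun x => v (f x)) =
      energy A fun a => v a := by
  have hf' : Function.Injective fun x => (⟨f x, hK x⟩ : {a // K a}) := fun x y h =>
    hf (congrArg Subtype.val h)
  rw [energy_submatrix hf']
  congr 1
  funext a
  obtain ⟨x, hx⟩ := hsurj a a.2
  have : a = ⟨f x, hK x⟩ := Subtype.ext hx.symm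
  rw [this, hf'.extend_apply]

namespace Interface

variable {d N : ℕ} {ι τ : Type*} [Fintype ι] [Fintype τ] {P : Problem d N ι τ} (G : Interface P)

/-- The restriction to a class of a function on the unknowns of a subdomain. -/
def res (c : G.Class) (m : G.I c) (v : P.W m.1 → ℝ) (x : G.Dof c) : ℝ := v (G.emb c m x)

theorem emb_injective (c : G.Class) (m : G.I c) : Function.Injective (G.emb c m) := by
  intro x y h
  exact Subtype.ext (congrArg (P.toΓ m.1) h)

theorem mem_I_cls {i : Fin N} (a : P.W i) : i ∈ G.I (G.cls (P.toΓ i a)) := a.1.2.2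

theorem mem_faces {i : Fin N} {c : G.Class} : c ∈ G.faces i ↔ G.IsFace c ∧ i ∈ G.I c := by
  simp [faces]

theorem mem_edges {i : Fin N} {c : G.Class} : c ∈ G.edges i ↔ G.IsEdge c ∧ i ∈ G.I c := by
  simp [edges]

theorem two_le_card_I {c : G.Class} (x : G.Dof c) : 2 ≤ (G.I c).card := by
  obtain ⟨x, rfl⟩ := x
  exact x.2.2

/-- Functions on `W_i` agree if they agree on the classes of `Ω_i`. -/
theorem funext_res {i : Fin N} {v w : P.W i → ℝ}
    (h : ∀ c (hi : i ∈ G.I c), G.res c ⟨i, hi⟩ v = G.res c ⟨i, hi⟩ w) : v = w :=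
  funext fun a => congrFun (h _ (G.mem_I_cls a)) ⟨P.toΓ i a, rfl⟩

theorem res_sub (c : G.Class) (m : G.I c) (v w : P.W m.1 → ℝ) :
    G.res c m (v - w) = G.res c m v - G.res c m w := rfl

/-- The block diagonal matrix on `W_i` with the given blocks on the classes of `Ω_i`. -/
noncomputable def blockMatrix (K : (c : G.Class) → G.I c → Matrix (G.Dof c) (G.Dof c) ℝ) (i : Fin N) :
    Matrix (P.W i) (P.W i) ℝ :=
  Matrix.of fun a b =>
    if h : G.cls (P.toΓ i b) = G.cls (P.toΓ i a) then
      K (G.cls (P.toΓ i a)) ⟨i, a.1.2.2⟩ ⟨P.toΓ i a, rfl⟩ ⟨P.toΓ i b, h⟩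
    else 0

theorem res_blockMatrix_mulVec (K : (c : G.Class) → G.I c → Matrix (G.Dof c) (G.Dof c) ℝ)
    (c : G.Class) (m : G.I c) (v : P.W m.1 → ℝ) :
    G.res c m (G.blockMatrix K m.1 *ᵥ v) = K c m *ᵥ G.res c m v := by
  funext x
  obtain ⟨x, rfl⟩ := x
  symm
  refine Finset.sum_of_injOn (G.emb _ m) (G.emb_injective _ m).injOn (by simp)
    (fun b _ hb => ?_) fun y _ => ?_
  · have h : ¬ G.cls (P.toΓ m.1 b) = G.cls x := fun h =>
      hb ⟨⟨P.toΓ m.1 b, h⟩, by simp, rfl⟩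
    have h0 : G.blockMatrix K m.1 (G.emb (G.cls x) m ⟨x, rfl⟩) b = 0 := dif_neg h
    exact (congrArg (· * v b) h0).trans (zero_mul _)
  · have h0 : G.blockMatrix K m.1 (G.emb (G.cls x) m ⟨x, rfl⟩) (G.emb (G.cls x) m y) =
      K (G.cls x) m ⟨x, rfl⟩ y := dif_pos y.2
    exact congrArg (· * v (G.emb (G.cls x) m y)) h0.symm

/-- The part of a function on `W_i` that lives on the class `c`. -/
noncomputable def part (c : G.Class) {i : Fin N} (v : P.W i → ℝ) (a : P.W i) : ℝ :=
  if G.cls (P.toΓ i a) = c then v a else 0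

theorem extend_res (c : G.Class) (m : G.I c) (v : P.W m.1 → ℝ) :
    Function.extend (G.emb c m) (G.res c m v) 0 = G.part c v := by
  funext a
  by_cases h : G.cls (P.toΓ m.1 a) = c
  · rw [part, if_pos h]
    exact (G.emb_injective c m).extend_apply (G.res c m v) 0 ⟨P.toΓ m.1 a, h⟩
  · rw [part, if_neg h, Function.extend_apply']
    · rfl
    · rintro ⟨x, rfl⟩
      exact h x.2

theorem energy_block (c : G.Class) (m : G.I c) (v : P.W m.1 → ℝ) :
    energy (G.block c m) (G.res c m v) = energy (P.S m.1) (G.part c v) := by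
  rw [block, energy_submatrix (G.emb_injective c m), extend_res]

theorem posSemidef_block (c : G.Class) (m : G.I c) : (G.block c m).PosSemidef :=
  (P.posSemidef_S m.1).submatrix _

theorem posSemidef_schurBlock (c : G.Class) (m : G.I c) : (G.schurBlock c m).PosSemidef :=
  (posSemidef_schur (P.posSemidef_S m.1) _).submatrix _

theorem energy_schurBlock_le (c : G.Class) (m : G.I c) (v : P.W m.1 → ℝ) :
    energy (G.schurBlock c m) (G.res c m v) ≤ energy (P.S m.1) v := by
  refine (le_of_eq ?_).trans
    (energy_schur_le (P.posSemidef_S m.1) (fun a => G.cls (P.toΓ m.1 a) = c) v)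
  exact energy_submatrix_subtype (G.emb_injective c m) (fun x => x.2)
    (fun a ha => ⟨⟨P.toΓ m.1 a, ha⟩, rfl⟩) _ v

theorem energy_tildeS_le (c : G.Class) (m : G.I c) (v : P.W m.1 → ℝ) :
    energy (G.tildeS c) (G.res c m v) ≤ energy (P.S m.1) v := by
  refine ((parallelSumList_spec _ ?_).2 (G.schurBlock c m) ?_ _).trans
    (G.energy_schurBlock_le c m v)
  · intro A hA
    obtain ⟨l, -, rfl⟩ := List.mem_map.1 hA
    exact G.posSemidef_schurBlock c l
  · exact List.mem_map.2 ⟨m, by simp, rfl⟩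

end Interface

/-! ### The partially coupled space -/

namespace Interface.Scaling.EigenSystem

variable {d N : ℕ} {ι τ : Type*} [Fintype ι] [Fintype τ] {P : Problem d N ι τ}
  {G : Interface P} {s : G.Scaling} (B : s.EigenSystem) (tol : ℝ)

theorem isUnit_changeBlock (c : G.Class) : IsUnit (B.changeBlock c) := by
  rw [changeBlock]
  split_ifs with h
  · exact isUnit_one
  · convert (B c h).isUnit_mat
    rfl

theorem res_change_mulVec (c : G.Class) (m : G.I c) (v : P.W m.1 → ℝ) :
    G.res c m (B.change m.1 *ᵥ v) = B.changeBlock c *ᵥ G.res c m v :=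
  G.res_blockMatrix_mulVec (fun c _ => B.changeBlock c) c m v

theorem res_local_mulVec (c : G.Class) (m : G.I c) (v : P.W m.1 → ℝ) :
    G.res c m (s.local m.1 *ᵥ v) = s.D c m *ᵥ G.res c m v :=
  G.res_blockMatrix_mulVec s.D c m v

theorem isUnit_change (i : Fin N) : IsUnit (B.change i) := by
  rw [← Matrix.mulVec_injective_iff_isUnit]
  intro v w h
  refine G.funext_res fun c hi => ?_
  have := congrArg (G.res c ⟨i, hi⟩) h
  rw [B.res_change_mulVec c ⟨i, hi⟩ v, B.res_change_mulVec c ⟨i, hi⟩ w] at this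
  exact Matrix.mulVec_injective_iff_isUnit.2 (B.isUnit_changeBlock c) this

theorem change_mulVec_D_mulVec (i : Fin N) (v : P.W i → ℝ) :
    B.change i *ᵥ B.D i *ᵥ v = s.local i *ᵥ B.change i *ᵥ v := by
  have h := (Matrix.isUnit_iff_isUnit_det _).1 (B.isUnit_change i)
  rw [D, Matrix.mulVec_mulVec, Matrix.mulVec_mulVec, Matrix.mul_assoc, ← Matrix.mul_assoc,
    Matrix.mul_nonsing_inv _ h, Matrix.one_mul]

theorem Rt_mulVec_of_not_isPrimal {i : Fin N} (w : B.Wt tol → ℝ) (a : P.W i)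
    (h : ¬ B.IsPrimal tol (P.toΓ i a)) :
    (B.Rt tol i *ᵥ w) a = w (Sum.inl ⟨i, a, h⟩) := by
  rw [Matrix.mulVec, dotProduct, Finset.sum_eq_single_of_mem (Sum.inl ⟨i, a, h⟩)
    (Finset.mem_univ _)]
  · simp [Rt]
  · rintro (⟨j, b, hb⟩ | x) - hne
    · have : ¬ (⟨i, a⟩ : Σ i, P.W i) = ⟨j, b⟩ := by
        intro e
        cases e
        exact hne rfl
      simp only [Rt, Matrix.of_apply, if_neg this, zero_mul]
    · have : ¬ P.toΓ i a = x.1 := fun e => h (e ▸ x.2)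
      simp only [Rt, Matrix.of_apply, if_neg this, zero_mul]

theorem Rt_mulVec_of_isPrimal {i : Fin N} (w : B.Wt tol → ℝ) (a : P.W i)
    (h : B.IsPrimal tol (P.toΓ i a)) :
    (B.Rt tol i *ᵥ w) a = w (Sum.inr ⟨P.toΓ i a, h⟩) := by
  rw [Matrix.mulVec, dotProduct, Finset.sum_eq_single_of_mem (Sum.inr ⟨P.toΓ i a, h⟩)
    (Finset.mem_univ _)]
  · simp [Rt]
  · rintro (⟨j, b, hb⟩ | x) - hne
    · have : ¬ (⟨i, a⟩ : Σ i, P.W i) = ⟨j, b⟩ := by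
        intro e
        cases e
        exact hb h
      simp only [Rt, Matrix.of_apply, if_neg this, zero_mul]
    · have : ¬ P.toΓ i a = x.1 := fun e => hne (congrArg Sum.inr (Subtype.ext e.symm))
      simp only [Rt, Matrix.of_apply, if_neg this, zero_mul]

theorem R_mulVec_inl (u : P.Γ → ℝ) (y : Σ i : Fin N, {a : P.W i // ¬ B.IsPrimal tol (P.toΓ i a)}) :
    (B.R tol *ᵥ u) (Sum.inl y) = u (P.toΓ y.1 y.2.1) := by
  simp [R, Matrix.mulVec, dotProduct]

theorem R_mulVec_inr (u : P.Γ → ℝ) (y : {x : P.Γ // B.IsPrimal tol x}) :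
    (B.R tol *ᵥ u) (Sum.inr y) = u y.1 := by
  simp [R, Matrix.mulVec, dotProduct]

theorem Rt_mulVec_R_mulVec (i : Fin N) (u : P.Γ → ℝ) (a : P.W i) :
    (B.Rt tol i *ᵥ B.R tol *ᵥ u) a = u (P.toΓ i a) := by
  by_cases h : B.IsPrimal tol (P.toΓ i a)
  · rw [B.Rt_mulVec_of_isPrimal tol _ a h, R_mulVec_inr]
  · rw [B.Rt_mulVec_of_not_isPrimal tol _ a h, R_mulVec_inl]

theorem Rt_mul_R_apply (i : Fin N) (a : P.W i) (x : P.Γ) :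
    (B.Rt tol i * B.R tol) a x = if P.toΓ i a = x then 1 else 0 := by
  have h := B.Rt_mulVec_R_mulVec tol i (Pi.single x 1) a
  rw [Matrix.mulVec_mulVec, Matrix.mulVec_single_one] at h
  exact h.trans (Pi.single_apply _ _ _)

/-- The nodal values in `Ω_i` of an element of the partially coupled space. -/
noncomputable def phys (w : B.Wt tol → ℝ) (i : Fin N) : P.W i → ℝ := B.change i *ᵥ B.Rt tol i *ᵥ w

theorem energy_St (w : B.Wt tol → ℝ) :
    energy (B.St tol) w = ∑ i, energy (P.S i) (B.phys tol w i) := by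
  rw [St, energy_matrix_sum]
  refine Finset.sum_congr rfl fun i _ => ?_
  rw [energy_transpose_mul_mul, S, energy_transpose_mul_mul, phys]

theorem posSemidef_St : (B.St tol).PosSemidef := by
  refine posSemidef_of_energy_nonneg ?_ fun w => ?_
  · have h : ∀ i, (P.S i)ᵀ = P.S i := fun i => transpose_eq_of_isHermitian (P.posSemidef_S i).1
    simp only [St, S, Matrix.transpose_sum, Matrix.transpose_mul, Matrix.transpose_transpose, h,
      Matrix.mul_assoc]
  · rw [energy_St]
    exact Finset.sum_nonneg fun i _ => energy_nonneg (P.posSemidef_S i) _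

/-- The averaging operator adds up the scaled local values. -/
theorem average_apply (w : B.Wt tol → ℝ) {c : G.Class} (x : G.Dof c) :
    (((B.R tol)ᵀ * B.Dt tol) *ᵥ w) x.1 =
      ∑ m : G.I c, G.res c m (B.D m.1 *ᵥ B.Rt tol m.1 *ᵥ w) x := by
  set v : (i : Fin N) → P.W i → ℝ := fun i => B.D i *ᵥ B.Rt tol i *ᵥ w with hv
  set F : Fin N → ℝ := fun i => ∑ a, (if P.toΓ i a = x.1 then 1 else 0) * v i a with hF
  have h1 : (((B.R tol)ᵀ * B.Dt tol) *ᵥ w) x.1 = ∑ i, F i := by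
    rw [Dt, Matrix.mul_sum, Matrix.sum_mulVec, Finset.sum_apply]
    refine Finset.sum_congr rfl fun i _ => ?_
    have e : (B.R tol)ᵀ * ((B.Rt tol i)ᵀ * B.D i * B.Rt tol i) =
        (B.Rt tol i * B.R tol)ᵀ * (B.D i * B.Rt tol i) := by
      rw [Matrix.transpose_mul]
      simp only [Matrix.mul_assoc]
    rw [e, ← Matrix.mulVec_mulVec, ← Matrix.mulVec_mulVec, Matrix.mulVec, dotProduct]
    simp only [Matrix.transpose_apply, Rt_mul_R_apply, hF, hv]
  have h2 : ∀ i ∉ G.I c, F i = 0 := by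
    intro i hi
    refine Finset.sum_eq_zero fun a _ => ?_
    have : ¬ P.toΓ i a = x.1 := by
      intro e
      have := G.mem_I_cls a
      rw [e, x.2] at this
      exact hi this
    rw [if_neg this, zero_mul]
  have h3 : ∀ m : G.I c, F m.1 = G.res c m (v m.1) x := by
    intro m
    rw [hF]
    dsimp only
    rw [Finset.sum_eq_single_of_mem (G.emb c m x) (Finset.mem_univ _)]
    · have : P.toΓ m.1 (G.emb c m x) = x.1 := rfl
      rw [if_pos this, one_mul]
      rfl
    · intro b _ hb
      have : ¬ P.toΓ m.1 b = x.1 := fun e => hb (by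
        refine Subtype.ext (Subtype.ext ?_)
        exact congrArg (fun z : P.Γ => z.1) e)
      rw [if_neg this, zero_mul]
  rw [h1, ← Finset.sum_subset (Finset.subset_univ (G.I c)) fun i _ hi => h2 i hi,
    ← Finset.sum_coe_sort]
  exact Finset.sum_congr rfl fun m _ => h3 m

theorem changeBlock_mulVec_average (w : B.Wt tol → ℝ) (c : G.Class) :
    B.changeBlock c *ᵥ (fun x : G.Dof c => (((B.R tol)ᵀ * B.Dt tol) *ᵥ w) x.1) =
      ∑ m : G.I c, s.D c m *ᵥ G.res c m (B.phys tol w m.1) := by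
  have h : (fun x : G.Dof c => (((B.R tol)ᵀ * B.Dt tol) *ᵥ w) x.1) =
      ∑ m : G.I c, G.res c m (B.D m.1 *ᵥ B.Rt tol m.1 *ᵥ w) := by
    funext x
    rw [B.average_apply tol w x, Finset.sum_apply]
  rw [h, Matrix.mulVec_sum]
  refine Finset.sum_congr rfl fun m _ => ?_
  rw [← B.res_change_mulVec, B.change_mulVec_D_mulVec, res_local_mulVec, phys]

theorem res_phys_R (u : P.Γ → ℝ) (c : G.Class) (m : G.I c) :
    G.res c m (B.phys tol (B.R tol *ᵥ u) m.1) = B.changeBlock c *ᵥ fun x => u x.1 := by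
  rw [phys, B.res_change_mulVec]
  congr 1
  funext x
  exact B.Rt_mulVec_R_mulVec tol m.1 u _

/-- The averaging operator is a left inverse of the embedding: the scalings are a partition of
unity. -/
theorem average_R_mulVec (u : P.Γ → ℝ) : ((B.R tol)ᵀ * B.Dt tol) *ᵥ B.R tol *ᵥ u = u := by
  funext x
  have h := B.changeBlock_mulVec_average tol (B.R tol *ᵥ u) (G.cls x)
  simp only [res_phys_R] at h
  rw [← Matrix.sum_mulVec, s.sum_eq_one, Matrix.one_mulVec] at h
  have := Matrix.mulVec_injective_iff_isUnit.2 (B.isUnit_changeBlock (G.cls x)) h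
  exact congrFun this ⟨x, rfl⟩

theorem res_phys_jump (w : B.Wt tol → ℝ) (c : G.Class) (m : G.I c) :
    G.res c m (B.phys tol (w - B.R tol *ᵥ ((B.R tol)ᵀ * B.Dt tol) *ᵥ w) m.1) =
      G.res c m (B.phys tol w m.1) - ∑ l : G.I c, s.D c l *ᵥ G.res c l (B.phys tol w l.1) := by
  rw [← B.changeBlock_mulVec_average, ← B.res_phys_R tol _ c m, ← Interface.res_sub]
  simp only [phys, Matrix.mulVec_sub]

end Interface.Scaling.EigenSystem

namespace Interface.Scaling.EigenSystem

variable {d N : ℕ} {ι τ : Type*} [Fintype ι] [Fintype τ] {P : Problem d N ι τ}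
  {G : Interface P} {s : G.Scaling} (B : s.EigenSystem) (tol : ℝ)

/-! ### Dual parts and the jump estimate -/

theorem isPrimal_of_isVertex {x : P.Γ} (h : G.IsVertex (G.cls x)) : B.IsPrimal tol x :=
  fun h' => absurd h h'

theorem val_le_of_not_isPrimal {c : G.Class} (hc : ¬ G.IsVertex c) (x : G.Dof c)
    (hx : ¬ B.IsPrimal tol x.1) : (B c hc).val x ≤ ENNReal.ofReal tol := by
  obtain ⟨x, rfl⟩ := x
  rw [IsPrimal] at hx
  push Not at hx
  obtain ⟨_, hface, hedge⟩ := hx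
  rcases (G.two_le_card_I ⟨x, rfl⟩).eq_or_lt with h | h
  · exact (hface ⟨hc, h.symm⟩).le
  · exact hedge ⟨hc, h⟩

theorem changeBlock_eq_mat {c : G.Class} (hc : ¬ G.IsVertex c) :
    B.changeBlock c = (B c hc).mat := dif_neg hc

/-- The dual part of the nodal values of `w` on the class `c`, in the subdomain `Ω_m`. -/
noncomputable def dualPart (w : B.Wt tol → ℝ) (c : G.Class) (m : G.I c) : G.Dof c → ℝ :=
  B.changeBlock c *ᵥ fun x =>
    if B.IsPrimal tol x.1 then 0 else G.res c m (B.Rt tol m.1 *ᵥ w) x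

/-- The primal part of the nodal values of `w` on the class `c`, which is the same in all the
subdomains sharing `c`. -/
noncomputable def primalPart (w : B.Wt tol → ℝ) (c : G.Class) : G.Dof c → ℝ :=
  B.changeBlock c *ᵥ fun x =>
    if h : B.IsPrimal tol x.1 then w (Sum.inr ⟨x.1, h⟩) else 0

theorem res_phys (w : B.Wt tol → ℝ) (c : G.Class) (m : G.I c) :
    G.res c m (B.phys tol w m.1) = B.primalPart tol w c + B.dualPart tol w c m := by
  rw [phys, B.res_change_mulVec, primalPart, dualPart, ← Matrix.mulVec_add]
  congr 1
  funext x
  by_cases h : B.IsPrimal tol x.1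
  · simp only [Pi.add_apply, dif_pos h, if_pos h, add_zero]
    exact B.Rt_mulVec_of_isPrimal tol w (G.emb c m x) h
  · simp only [Pi.add_apply, dif_neg h, if_neg h, zero_add]

/-- The dual part contains only eigenvectors with eigenvalue at most the tolerance, and the
parallel sum is bounded by each of its terms. -/
theorem energy_dualPart_le (htol : 0 < tol) (w : B.Wt tol → ℝ) {c : G.Class}
    (hc : ¬ G.IsVertex c) (m : G.I c) :
    energy (s.A c) (B.dualPart tol w c m) ≤ tol * energy (P.S m.1) (B.phys tol w m.1) := by
  refine le_trans ?_
    (mul_le_mul_of_nonneg_left (G.energy_tildeS_le c m (B.phys tol w m.1)) htol.le)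
  rw [phys, B.res_change_mulVec, dualPart, B.changeBlock_eq_mat hc]
  refine (B c hc).energy_mat_mulVec_le htol fun x => ?_
  by_cases h : B.IsPrimal tol x.1
  · exact Or.inl (if_pos h)
  · exact Or.inr ⟨if_neg h, B.val_le_of_not_isPrimal tol hc x h⟩

/-- The average of the nodal values, subtracted from them, leaves only dual parts. -/
theorem res_phys_jump_eq (w : B.Wt tol → ℝ) (c : G.Class) (m : G.I c) :
    G.res c m (B.phys tol (w - B.R tol *ᵥ ((B.R tol)ᵀ * B.Dt tol) *ᵥ w) m.1) =
      B.dualPart tol w c m - ∑ l : G.I c, s.D c l *ᵥ B.dualPart tol w c l := by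
  rw [B.res_phys_jump]
  simp only [B.res_phys, Matrix.mulVec_add, Finset.sum_add_distrib]
  rw [← Matrix.sum_mulVec, s.sum_eq_one, Matrix.one_mulVec]
  abel

theorem dualPart_eq_zero_of_isVertex (w : B.Wt tol → ℝ) {c : G.Class} (hc : G.IsVertex c)
    (m : G.I c) : B.dualPart tol w c m = 0 := by
  have : (fun x : G.Dof c => if B.IsPrimal tol x.1 then 0
      else G.res c m (B.Rt tol m.1 *ᵥ w) x) = 0 := by
    funext x
    exact if_pos (B.isPrimal_of_isVertex tol (by rwa [x.2]))
  rw [dualPart, this, Matrix.mulVec_zero]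

theorem sum_energy_block_jump_le (htol : 0 < tol) (w : B.Wt tol → ℝ) {c : G.Class}
    (hc : ¬ G.IsVertex c) :
    ∑ i ∈ G.I c, energy (P.S i) (G.part c
        (B.phys tol (w - B.R tol *ᵥ ((B.R tol)ᵀ * B.Dt tol) *ᵥ w) i)) ≤
      2 * (((G.I c).card : ℝ) - 1) * tol * ∑ i ∈ G.I c, energy (P.S i) (B.phys tol w i) := by
  set z := w - B.R tol *ᵥ ((B.R tol)ᵀ * B.Dt tol) *ᵥ w with hz
  rw [← Finset.sum_coe_sort, ← Finset.sum_coe_sort (G.I c)]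
  have h := sum_energy_jump_le (s.sum_eq_one c) (G.posSemidef_block c) (B.dualPart tol w c)
  simp only [← B.res_phys_jump_eq, ← hz, G.energy_block] at h
  refine h.trans ?_
  rw [Fintype.card_coe, mul_assoc _ tol, Finset.mul_sum (a := tol)]
  rcases (G.I c).eq_empty_or_nonempty with h0 | h0
  · have : IsEmpty (G.I c) := by rw [h0]; infer_instance
    simp
  have h1 : (1 : ℝ) ≤ (G.I c).card := by exact_mod_cast h0.card_pos
  exact mul_le_mul_of_nonneg_left
    (Finset.sum_le_sum fun m _ => B.energy_dualPart_le tol htol w hc m) (by linarith)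

/-- On `W_i` the jump is the sum of its parts on the faces and edges of `Ω_i`. -/
theorem phys_jump_eq_sum (w : B.Wt tol → ℝ) (i : Fin N) :
    let v := B.phys tol (w - B.R tol *ᵥ ((B.R tol)ᵀ * B.Dt tol) *ᵥ w) i
    v = ∑ c ∈ G.faces i, G.part c v + ∑ c ∈ G.edges i, G.part c v := by
  intro v
  funext a
  set c := G.cls (P.toΓ i a) with hc
  have hi : i ∈ G.I c := G.mem_I_cls a
  have hsum : ∀ F : Finset G.Class, (∑ c' ∈ F, G.part c' v) a = if c ∈ F then v a else 0 := by
    intro F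
    rw [Finset.sum_apply]
    simp only [Interface.part]
    rw [Finset.sum_ite_eq]
  rw [Pi.add_apply, hsum, hsum]
  by_cases hv : G.IsVertex c
  · have h0 : v a = 0 := by
      have h := B.res_phys_jump_eq tol w c ⟨i, hi⟩
      simp only [B.dualPart_eq_zero_of_isVertex tol w hv, Matrix.mulVec_zero,
        Finset.sum_const_zero, sub_zero] at h
      exact congrFun h ⟨P.toΓ i a, rfl⟩
    simp [h0]
  · rcases (G.two_le_card_I (c := c) ⟨P.toΓ i a, rfl⟩).eq_or_lt with h | h
    · have h1 : c ∈ G.faces i := G.mem_faces.2 ⟨⟨hv, h.symm⟩, hi⟩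
      have h2 : c ∉ G.edges i := fun h' => (G.mem_edges.1 h').1.2.ne h
      rw [if_pos h1, if_neg h2, add_zero]
    · have h1 : c ∉ G.faces i := fun h' => h.ne' (G.mem_faces.1 h').1.2
      have h2 : c ∈ G.edges i := G.mem_edges.2 ⟨⟨hv, h⟩, hi⟩
      rw [if_neg h1, if_pos h2, zero_add]

/-- The jump estimate. The factor `8` is `2` from the constant of `sum_energy_jump_le`, `2` from
separating faces and edges in a subdomain, and `2` from bounding a sum by twice a maximum. The
remaining factor `|I(c)| - 1` is `1` on a face and at most `|I(c)|` on an edge. -/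
theorem energy_jump_le (htol : 0 < tol) (w : B.Wt tol → ℝ) :
    energy (B.St tol) (w - B.R tol *ᵥ ((B.R tol)ᵀ * B.Dt tol) *ᵥ w) ≤
      (G.constC : ℝ) * tol * energy (B.St tol) w := by
  set v := B.phys tol (w - B.R tol *ᵥ ((B.R tol)ᵀ * B.Dt tol) *ᵥ w) with hv
  set ε : Fin N → ℝ := fun i => energy (P.S i) (B.phys tol w i)
  set g : G.Class → Fin N → ℝ := fun c i => energy (P.S i) (G.part c (v i))
  set KF := Finset.univ.sup fun i => (G.faces i).card ^ 2 with hKF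
  set KE := Finset.univ.sup fun i => (G.edges i).card ^ 2 * (G.edges i).sup fun E => (G.I E).card
    with hKE
  have hε : ∀ i, 0 ≤ ε i := fun i => energy_nonneg (P.posSemidef_S i) _
  have hg : ∀ c i, 0 ≤ g c i := fun c i => energy_nonneg (P.posSemidef_S i) _
  have hfaces : ∑ i, ((G.faces i).card : ℝ) * ∑ c ∈ G.faces i, g c i ≤
      2 * tol * KF * ∑ i, ε i := by
    refine sum_card_mul_sum_le G.IsFace G.I g ε (fun _ => 2 * tol) G.faces
      (fun _ _ => G.mem_faces) hε hg (fun _ _ => by positivity) (fun c hc => ?_)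
      (by positivity) fun i c _ => ?_
    · have h := B.sum_energy_block_jump_le tol htol w hc.1
      have e : 2 * (((2 : ℕ) : ℝ) - 1) * tol = 2 * tol := by
        push_cast
        ring
      rw [hc.2, e] at h
      exact h
    · rw [mul_comm]
      refine mul_le_mul_of_nonneg_left ?_ (by positivity)
      exact_mod_cast Finset.le_sup (f := fun i => (G.faces i).card ^ 2) (Finset.mem_univ i)
  have hedges : ∑ i, ((G.edges i).card : ℝ) * ∑ c ∈ G.edges i, g c i ≤
      2 * tol * KE * ∑ i, ε i := by
    refine sum_card_mul_sum_le G.IsEdge G.I g ε (fun c => 2 * tol * (G.I c).card) G.edges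
      (fun _ _ => G.mem_edges) hε hg (fun _ _ => by positivity) (fun c hc => ?_)
      (by positivity) fun i c hc => ?_
    · refine (B.sum_energy_block_jump_le tol htol w hc.1).trans ?_
      refine mul_le_mul_of_nonneg_right ?_ (Finset.sum_nonneg fun i _ => hε i)
      nlinarith
    · have h1 : (G.edges i).card ^ 2 * (G.I c).card ≤ KE :=
        (Nat.mul_le_mul_left _ (Finset.le_sup (f := fun E => (G.I E).card) hc)).trans
          (Finset.le_sup (f := fun i => (G.edges i).card ^ 2 *
            (G.edges i).sup fun E => (G.I E).card) (Finset.mem_univ i))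
      have h2 : ((G.edges i).card : ℝ) ^ 2 * (G.I c).card ≤ KE := by exact_mod_cast h1
      nlinarith
  have hlocal : ∀ i, energy (P.S i) (v i) ≤
      2 * (((G.faces i).card : ℝ) * ∑ c ∈ G.faces i, g c i) +
        2 * (((G.edges i).card : ℝ) * ∑ c ∈ G.edges i, g c i) := by
    intro i
    have e : v i = ∑ c ∈ G.faces i, G.part c (v i) + ∑ c ∈ G.edges i, G.part c (v i) :=
      B.phys_jump_eq_sum tol w i
    have hS := P.posSemidef_S i
    calc energy (P.S i) (v i)
        ≤ 2 * energy (P.S i) (∑ c ∈ G.faces i, G.part c (v i)) +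
          2 * energy (P.S i) (∑ c ∈ G.edges i, G.part c (v i)) := by
          conv_lhs => rw [e]
          exact energy_add_le hS _ _
      _ ≤ _ := add_le_add
          (mul_le_mul_of_nonneg_left (energy_sum_le hS _ _) zero_le_two)
          (mul_le_mul_of_nonneg_left (energy_sum_le hS _ _) zero_le_two)
  have hC : (G.constC : ℝ) = 8 * max (KF : ℝ) KE := by
    rw [Interface.constC]
    push_cast
    rfl
  have hsum : 0 ≤ ∑ i, ε i := Finset.sum_nonneg fun i _ => hε i
  have h1 : tol * (∑ i, ε i) * KF ≤ tol * (∑ i, ε i) * max (KF : ℝ) KE :=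
    mul_le_mul_of_nonneg_left (le_max_left _ _) (by positivity)
  have h2 : tol * (∑ i, ε i) * KE ≤ tol * (∑ i, ε i) * max (KF : ℝ) KE :=
    mul_le_mul_of_nonneg_left (le_max_right _ _) (by positivity)
  rw [energy_St, energy_St, hC]
  refine (Finset.sum_le_sum fun i _ => hlocal i).trans ?_
  rw [Finset.sum_add_distrib, ← Finset.mul_sum, ← Finset.mul_sum]
  change _ ≤ 8 * max (KF : ℝ) KE * tol * ∑ i, ε i
  linarith

/-! ### Definiteness of the partially coupled matrix -/

/-- An element without energy has no dual coefficients, so it comes from the fully coupled space,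
on which the interface energy is definite. -/
theorem posDef_St (hd : 0 < d) (htol : 0 < tol) : (B.St tol).PosDef := by
  refine posDef_of_posSemidef_of_energy (B.posSemidef_St tol) fun w hw => ?_
  rw [energy_St, Finset.sum_eq_zero_iff_of_nonneg
    fun i _ => energy_nonneg (P.posSemidef_S i) _] at hw
  have h0 : ∀ i, energy (P.S i) (B.phys tol w i) = 0 := fun i => hw i (Finset.mem_univ i)
  have hdual : ∀ (i : Fin N) (a : P.W i) (h : ¬ B.IsPrimal tol (P.toΓ i a)),
      w (Sum.inl ⟨i, a, h⟩) = 0 := by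
    intro i a h
    set c := G.cls (P.toΓ i a) with hc
    have hv : ¬ G.IsVertex c := fun hv => h (B.isPrimal_of_isVertex tol hv)
    have h1 := B.energy_dualPart_le tol htol w hv ⟨i, G.mem_I_cls a⟩
    rw [h0, mul_zero, dualPart, B.changeBlock_eq_mat hv, EigenBasis.energy_mat_mulVec] at h1
    have h2 := (Finset.sum_eq_zero_iff_of_nonneg fun _ _ => sq_nonneg _).1
      (le_antisymm h1 (Finset.sum_nonneg fun _ _ => sq_nonneg _)) ⟨P.toΓ i a, rfl⟩
      (Finset.mem_univ _)
    rw [sq_eq_zero_iff, if_neg h] at h2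
    rw [← B.Rt_mulVec_of_not_isPrimal tol w a h]
    exact h2
  set u : P.Γ → ℝ := fun x => if h : B.IsPrimal tol x then w (Sum.inr ⟨x, h⟩) else 0
  have hup : ∀ x (h : B.IsPrimal tol x), u x = w (Sum.inr ⟨x, h⟩) := fun x h => dif_pos h
  have hun : ∀ x, ¬ B.IsPrimal tol x → u x = 0 := fun x h => dif_neg h
  have hwu : w = B.R tol *ᵥ u := by
    funext t
    rcases t with ⟨i, a, h⟩ | ⟨x, h⟩
    · rw [hdual i a h, R_mulVec_inl]
      exact (hun _ h).symm
    · rw [R_mulVec_inr]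
      exact (hup _ h).symm
  -- the nodal values of `u`
  set U : P.Γ → ℝ := fun x => (B.changeBlock (G.cls x) *ᵥ fun y => u y.1) ⟨x, rfl⟩
  have hU : ∀ i, B.phys tol w i = fun a => U (P.toΓ i a) := by
    intro i
    funext a
    rw [hwu]
    exact congrFun (B.res_phys_R tol u (G.cls (P.toΓ i a)) ⟨i, G.mem_I_cls a⟩)
      ⟨P.toΓ i a, rfl⟩
  have hU0 : U = 0 := P.eq_zero_of_energy_S_eq_zero hd fun i => by rw [← hU, h0]
  have hu0 : u = 0 := by
    funext x
    have h1 : ∀ c, (B.changeBlock c *ᵥ fun y => u y.1) = B.changeBlock c *ᵥ 0 := by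
      intro c
      rw [Matrix.mulVec_zero]
      funext ⟨y, hy⟩
      subst hy
      exact congrFun hU0 y
    exact congrFun (Matrix.mulVec_injective_iff_isUnit.2 (B.isUnit_changeBlock (G.cls x)) (h1 _))
      ⟨x, rfl⟩
  rw [hwu, hu0, Matrix.mulVec_zero]

end Interface.Scaling.EigenSystem

end BDDC

theorem mainTheorem1 {d N : ℕ} (hd : d = 2 ∨ d = 3) {ι τ : Type*} [Fintype ι] [Fintype τ]
    (P : BDDC.Problem d N ι τ) (G : BDDC.Interface P) (s : G.Scaling) (B : s.EigenSystem)
    (tol : ℝ) (htol : 1 ≤ (G.constC : ℝ) * tol) :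
    (B.St tol).PosDef ∧ (B.interfaceMatrix tol).PosDef ∧ (B.precond tol).PosDef ∧
      BDDC.condNumber (B.preconditioned tol) ≤ (G.constC : ℝ) * tol := by
  classical
  have hd0 : 0 < d := by omega
  have htol0 : 0 < tol := pos_of_mul_pos_right (by linarith) (Nat.cast_nonneg G.constC)
  have hS := B.posDef_St tol hd0 htol0
  have hR := B.average_R_mulVec tol
  refine ⟨hS, BDDC.posDef_transpose_mul_mul_of_leftInverse hS hR, BDDC.posDef_precond hS hR,
    BDDC.condNumber_le (by linarith) fun t ht =>
      BDDC.mem_Icc_of_mem_spectrum hS hR htol (B.energy_jump_le tol htol0) ht⟩
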